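/- **Setting.** Let $q\ge 1$ and let qudits of dimension $q$ sit at the sites of the infinite chain $\mathbb Z$ or of a circle $\mathbb Z/L$ with $L$ even. Start with a product of pure one-qudit states and apply layers $t=1,2,\dots$ of two-site gates: layer $t$ acts on the pairs $\{x,x+1\}$ with $x+t$ even, all gates being independent and Haar distributed in $\mathsf U(q^2)$. Let $\rho$ be the reduced density matrix after $T\ge 0$ layers on an interval of even length $\ell\ge 2$ both of whose end points are straddled by a gate of the last layer (if $T\ge1$). Let $\mathbb E$ be the average over the gates, $P(T;\ell)=\mathbb E\,\mathrm{Tr}\,\rho^2$ the averaged purity on the infinite chain, $\|\cdot\|_1$ and $\|\cdot\|_2$ the trace and Hilbert–Schmidt norms, and $\tau=\mathbf 1/q^\ell$ the maximally mixed state. For a tolerance $\delta>0$ let $\mathfrak C_\delta(\sigma)$ be the least number of quantum channels, each on two neighbouring qudits of a line, that produce from a product of one-qudit density matrices a state $\sigma'$ with $\frac12\|\sigma-\sigma'\|_1\le\delta$; ancillary qudits may be inserted and qudits discarded in between at no cost. **(a) Purity.** On the infinite chain, for all integers $q\ge 1$, $T\ge 0$ and even $\ell\ge 2$, $$\frac{1-q^{-2}}{T+1}\binom{2T}{T}\Big(\frac{q}{q^2+1}\Big)^{2T}\;\le\;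 P(T;\ell)-\frac1{q^\ell}\;\le\;\Big(\frac{2q}{q^2+1}\Big)^{2T}.$$ **(b) Thermalization on the infinite chain.** For every choice of the gates $\|\rho-\tau\|_1\le q^{\ell/2}\|\rho-\tau\|_2$, and $$\big(\mathbb E\|\rho-\tau\|_1^2\big)^{1/2}\le q^{\ell/2}\big(\mathbb E\|\rho-\tau\|_2^2\big)^{1/2}=\sqrt{q^\ell P(T;\ell)-1}.$$ If $q\ge 2$ and $0<\varepsilon\le 2$, the right-hand side is less than $\varepsilon$ as soon as $$T>\frac\ell2\Big(1+3\,\frac{\log 2}{\log q}\Big)+\frac{3\log(1/\varepsilon)}{\log q},$$ provided that $q\ge 3$, or $q=2$ and $\varepsilon\ge 2^{-4\ell}$; for $q=2$ and every $0<\varepsilon\le2$ the same holds with the second term replaced by $4\log(1/\varepsilon)/\log q$. Moreover, for such $T$ and every $\delta>0$, $\Pr[\mathfrak C_\delta(\rho)\ne 0]\le(\varepsilon/2\delta)^2$. **(c) Circle.** On a circle of $L$ sites ($L$ even) with $\ell+2T\le L$, the averaged purity of the interval equals $P(T;\ell)$. **(d) Intervals smaller than half.** Let $q\ge 2$, $L$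 even, $\ell<\frac L2\big(1-6\frac{\log2}{\log q}\big)$ and $T_1=\frac\ell2\big(1+6\frac{\log 2}{\log q}\big)$. Then $\ell+2\lceil T_1\rceil\le L$, and at every integer time $T\ge T_1$ with $\ell+2T\le L$ the interval on the circle satisfies $(\mathbb E\|\rho-\tau\|_1^2)^{1/2}<2^{-\ell/2}$ and, for every $\delta>0$, $\Pr[\mathfrak C_\delta(\rho)\ne0]\le(2^{-\ell/2}/2\delta)^2$. -/

import Mathlib

open MeasureTheory

namespace Brickwork

noncomputable section

/-! ### Haar-random gates -/

/-- Two-qudit gates: unitary matrices on `ℂ^q ⊗ ℂ^q`, that is, elements of `U(q²)`. -/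
abbrev Gate (q : ℕ) : Type := Matrix.unitaryGroup (Fin q × Fin q) ℂ

instance instCompactSpaceGate (q : ℕ) : CompactSpace (Gate q) := by
  suffices h : IsCompact ((Matrix.unitaryGroup (Fin q × Fin q) ℂ :
      Submonoid (Matrix (Fin q × Fin q) (Fin q × Fin q) ℂ)) :
      Set (Matrix (Fin q × Fin q) (Fin q × Fin q) ℂ)) from isCompact_iff_compactSpace.mp h
  have hK : IsCompact (Set.pi Set.univ fun _ : Fin q × Fin q =>
      Set.pi Set.univ fun _ : Fin q × Fin q => Metric.closedBall (0 : ℂ) 1) :=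
    isCompact_univ_pi fun _ => isCompact_univ_pi fun _ => isCompact_closedBall _ _
  refine IsCompact.of_isClosed_subset hK ?_ ?_
  · have h : ((Matrix.unitaryGroup (Fin q × Fin q) ℂ :
        Submonoid (Matrix (Fin q × Fin q) (Fin q × Fin q) ℂ)) :
        Set (Matrix (Fin q × Fin q) (Fin q × Fin q) ℂ)) = {A | A * star A = 1} := by
      ext A
      exact Matrix.mem_unitaryGroup_iff
    rw [h]
    exact isClosed_eq (continuous_id.mul continuous_star) continuous_const
  · intro A hA i _ j _
    simpa using entry_norm_bound_of_unitary hA i j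

instance instMeasurableSpaceGate (q : ℕ) : MeasurableSpace (Gate q) := borel _

instance instBorelSpaceGate (q : ℕ) : BorelSpace (Gate q) := ⟨rfl⟩

/-- The Haar probability measure on `U(q²)`. -/
def haarGate (q : ℕ) : Measure (Gate q) :=
  Measure.haarMeasure (⊤ : TopologicalSpace.PositiveCompacts (Gate q))

instance instIsProbabilityMeasureHaarGate (q : ℕ) : IsProbabilityMeasure (haarGate q) :=
  ⟨Measure.haarMeasure_self⟩

/-- A choice of all the gates of a circuit on the sites `V`: the gate `U (t, x)` is the one that
layer `t` applies to the sites `x, x + 1` (see `layerMatrix`). -/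
abbrev Circuit (q : ℕ) (V : Type) : Type := ℕ × V → Gate q

/-- The random circuit: all gates are independent and Haar distributed. -/
def circuitMeasure (q : ℕ) (V : Type) : Measure (Circuit q V) :=
  Measure.infinitePi fun _ => haarGate q

/-! ### The brickwork dynamics

The sites `V` are `ℤ` (infinite chain) or `ZMod L` with `L` even (circle). A state of the chain
is the family of its reduced density matrices on all finite sets of sites.
-/

section Dynamics

variable {q : ℕ} {V : Type} [AddCommGroupWithOne V] [DecidableEq V]

/-- Operators on the qudits at the sites in `Λ`, in the computational basis. -/
abbrev LocalOp (q : ℕ) (Λ : Finset V) : Type := Matrix (Λ → Fin q) (Λ → Fin q) ℂ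

/-- Joins a configuration on `Λ` and one on `M \ Λ` to a configuration on `M`. -/
def glue {Λ M : Finset V} (σ : Λ → Fin q) (κ : ↥(M \ Λ) → Fin q) : M → Fin q := fun x =>
  if h : x.1 ∈ Λ then σ ⟨x.1, h⟩ else κ ⟨x.1, Finset.mem_sdiff.mpr ⟨x.2, h⟩⟩

/-- The partial trace over the sites in `M \ Λ`; used for `Λ ⊆ M`. -/
def partialTrace (Λ : Finset V) {M : Finset V} (ρ : LocalOp q M) : LocalOp q Λ :=
  Matrix.of fun σ τ => ∑ κ : ↥(M \ Λ) → Fin q, ρ (glue σ κ) (glue τ κ)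

/-- The reduced density matrix on `Λ` of the product state `⨂ₓ |φ x⟩⟨φ x|`. -/
def productState (φ : V → EuclideanSpace ℂ (Fin q)) (Λ : Finset V) : LocalOp q Λ :=
  Matrix.of fun σ τ => ∏ x : Λ, φ x.1 (σ x) * star (φ x.1 (τ x))

open scoped Classical in
/-- Layer `t` pairs `x` with `x + 1` whenever `x + t` is even; this is the other site of the
pair that `x` belongs to. -/
def partner (t : ℕ) (x : V) : V := if Even (x + (t : V)) then x + 1 else x - 1

/-- The union of all pairs of layer `t` that meet `Λ`. -/
def hull (t : ℕ) (Λ : Finset V) : Finset V := Λ ∪ Λ.image (partner t)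

open scoped Classical in
/-- The tensor product of the gates of layer `t` acting inside `M`, where `M` is a union of pairs
of layer `t`. -/
def layerMatrix (U : Circuit q V) (t : ℕ) (M : Finset V) : LocalOp q M :=
  Matrix.of fun σ τ => ∏ x : M,
    if h : Even (x.1 + (t : V)) ∧ x.1 + 1 ∈ M then
      (U (t, x.1)).1 (σ x, σ ⟨x.1 + 1, h.2⟩) (τ x, τ ⟨x.1 + 1, h.2⟩)
    else 1

/-- The reduced density matrices after the layers `1, …, t`, starting with the product state.
A layer acts by conjugation on the sites of the pairs that meet `Λ`; the sites outside `Λ` are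
then traced out. -/
def circuitState (φ : V → EuclideanSpace ℂ (Fin q)) (U : Circuit q V) :
    ℕ → (Λ : Finset V) → LocalOp q Λ
  | 0, Λ => productState φ Λ
  | t + 1, Λ =>
    let M := hull (t + 1) Λ
    let W := layerMatrix U (t + 1) M
    partialTrace Λ (W * circuitState φ U t M * W.conjTranspose)

/-- The sites `a, a + 1, …, a + ℓ - 1`. -/
def interval (a : V) (ℓ : ℕ) : Finset V :=
  Finset.univ.image fun i : Fin ℓ => a + ((i : ℕ) : V)

/-- The label `i` of a site `a + i` of an interval (unique if these sites are distinct). -/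
def intervalLabel (a : V) (ℓ : ℕ) (x : interval a ℓ) : Fin ℓ :=
  (Finset.mem_image.mp x.2).choose

/-- The reduced density matrix at time `T` of the interval `a, …, a + ℓ - 1`, with its sites
labelled by `0, …, ℓ - 1`. -/
def intervalState (φ : V → EuclideanSpace ℂ (Fin q)) (U : Circuit q V) (T : ℕ) (a : V) (ℓ : ℕ) :
    Matrix (Fin ℓ → Fin q) (Fin ℓ → Fin q) ℂ :=
  (circuitState φ U T (interval a ℓ)).submatrix
    (fun σ x => σ (intervalLabel a ℓ x)) (fun σ x => σ (intervalLabel a ℓ x))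

/-- The purity `Tr ρ²`. -/
def purity {n : Type} [Fintype n] (ρ : Matrix n n ℂ) : ℝ := (ρ * ρ).trace.re

/-- The ensemble-averaged purity of the interval `a, …, a + ℓ - 1` at time `T`. -/
def avgPurity (φ : V → EuclideanSpace ℂ (Fin q)) (T : ℕ) (a : V) (ℓ : ℕ) : ℝ :=
  ∫ U, purity (intervalState φ U T a ℓ) ∂(circuitMeasure q V)

end Dynamics

/-! ### Norms -/

/-- The trace norm `Tr √(Aᴴ A)`, the sum of the singular values. -/
def traceNorm {n : Type} [Fintype n] [DecidableEq n] (A : Matrix n n ℂ) : ℝ :=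
  ∑ i, √((Matrix.isHermitian_conjTranspose_mul_self A).eigenvalues i)

/-- The Hilbert–Schmidt norm `√(Tr Aᴴ A)`. -/
def hsNorm {n : Type} [Fintype n] (A : Matrix n n ℂ) : ℝ := √(A.conjTranspose * A).trace.re

/-- The maximally mixed state of `ℓ` qudits. -/
def maxMixed (q ℓ : ℕ) : Matrix (Fin ℓ → Fin q) (Fin ℓ → Fin q) ℂ := ((q : ℂ) ^ ℓ)⁻¹ • 1

/-! ### Complexity of mixed states -/

open scoped ComplexOrder in
/-- Density matrices. -/
def IsDensity {n : Type} [Fintype n] (ρ : Matrix n n ℂ) : Prop := ρ.PosSemidef ∧ ρ.trace = 1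

/-- The product `η₀ ⊗ ⋯ ⊗ ηₙ₋₁` on a line of `n` qudits. -/
def tensor {q n : ℕ} (η : Fin n → Matrix (Fin q) (Fin q) ℂ) :
    Matrix (Fin n → Fin q) (Fin n → Fin q) ℂ :=
  Matrix.of fun σ τ => ∏ i, η i (σ i) (τ i)

open scoped Classical in
/-- A two-qudit operator acting on the neighbouring qudits `i, j` of a line of `n` qudits, as the
identity on the others. -/
def onPair {q n : ℕ} (i j : Fin n) (K : Matrix (Fin q × Fin q) (Fin q × Fin q) ℂ) :
    Matrix (Fin n → Fin q) (Fin n → Fin q) ℂ :=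
  Matrix.of fun σ τ =>
    if ∀ k, k ≠ i → k ≠ j → σ k = τ k then K (σ i, σ j) (τ i, τ j) else 0

/-- `Preparable q N n ρ`: the state `ρ` of a line of `n` qudits is obtained from a product state
by `N` quantum channels (in Kraus form), each on two neighbouring qudits, where ancillary qudits
may be inserted and qudits may be discarded between the channels at no cost. -/
inductive Preparable (q : ℕ) :
    ℕ → (n : ℕ) → Matrix (Fin n → Fin q) (Fin n → Fin q) ℂ → Prop
  | product {n : ℕ} (η : Fin n → Matrix (Fin q) (Fin q) ℂ) (hη : ∀ i, IsDensity (η i)) :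
      Preparable q 0 n (tensor η)
  | channel {N n r : ℕ} {ρ : Matrix (Fin n → Fin q) (Fin n → Fin q) ℂ} (hρ : Preparable q N n ρ)
      (i j : Fin n) (hij : (i : ℕ) + 1 = j)
      (K : Fin r → Matrix (Fin q × Fin q) (Fin q × Fin q) ℂ)
      (hK : ∑ k, (K k).conjTranspose * K k = 1) :
      Preparable q (N + 1) n (∑ k, onPair i j (K k) * ρ * (onPair i j (K k)).conjTranspose)
  | insert {N n : ℕ} {ρ : Matrix (Fin n → Fin q) (Fin n → Fin q) ℂ} (hρ : Preparable q N n ρ)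
      (i : Fin (n + 1)) (η : Matrix (Fin q) (Fin q) ℂ) (hη : IsDensity η) :
      Preparable q N (n + 1)
        (Matrix.of fun σ τ => η (σ i) (τ i) * ρ (i.removeNth σ) (i.removeNth τ))
  | discard {N n : ℕ} {ρ : Matrix (Fin (n + 1) → Fin q) (Fin (n + 1) → Fin q) ℂ}
      (hρ : Preparable q N (n + 1) ρ) (i : Fin (n + 1)) :
      Preparable q N n
        (Matrix.of fun σ τ => ∑ k : Fin q, ρ (i.insertNth k σ) (i.insertNth k τ))

/-- The complexity of a state at tolerance `δ`: the least number of elementary channels that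
prepare it up to trace distance `δ`. -/
def complexity {q n : ℕ} (δ : ℝ) (σ : Matrix (Fin n → Fin q) (Fin n → Fin q) ℂ) : ℕ∞ :=
  ⨅ N ∈ {N : ℕ | ∃ ρ, Preparable q N n ρ ∧ traceNorm (σ - ρ) / 2 ≤ δ}, (N : ℕ∞)

end

end Brickwork

namespace Brickwork

noncomputable section

/-! ### The second moment of the Haar measure -/

section Commutant

variable {n : Type*} [Fintype n] [DecidableEq n]

/-! The purity of a region A is the expectation value in ρ ⊗ ρ of the operator exchanging two
replicas on A (`sitePurity`). A gate with both sites inside A or both outside commutes with this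
operator and drops out by unitarity. A gate across the boundary has to be averaged. By Haar
invariance its second moment commutes with all v ⊗ v, so it is a combination of identity and swap
(`TensorInvariant.exists_eq`). The two traces of the exchange operator, both q³, then give each the
weight K = q/(q²+1). So on average such a gate replaces A by K times A with the pair added plus K
times A with the pair removed.

Take an interval of 2d sites whose two ends are cut by the last layer. Averaging the two end gates
leaves one interval with d+1, two with d and one with d-1 in place of d. Their ends are aligned with
the pairs of that layer, so the rest of the layer drops out, and the layer before cuts them again.
Hence P_{t+1}(d) = K²(P_t(d+1) + 2P_t(d) + P_t(d-1)), with P_t(0) = 1 and P_0 = 1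
(`integral_sitePurity_interval`). Only the alternation of even and odd sites and the distinctness of
2d + 2T consecutive sites enter, so the infinite chain and a large enough circle give the same
numbers.

The values q^{-2d} are stationary under the recursion. The excess over them solves the same linear
recursion, vanishes at d = 0 and starts in [0,1]; the weights sum to 4K², so it is at most (4K²)^t.
For the lower bound it is compared with a random walk killed at 0, solved by reflection
(`purityRec_sub_lower`).

Cauchy–Schwarz on the singular values and ‖ρ-τ‖₂² = Tr ρ² - q^{-ℓ} bound the mean of ‖ρ-τ‖₁² by q^ℓ
P - 1 ≤ q^{2d}(4K²)^T for ℓ = 2d. This is below ε² once T log((q²+1)/(2q)) exceeds d log q +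
log(1/ε), and the stated times follow by elementary estimates. Since τ is a product state, the
complexity bounds are Markov's inequality for ‖ρ-τ‖₁². -/

/-- Four-index tensors invariant under `v ⊗ v ⊗ v̄ ⊗ v̄` for all unitaries `v`. -/
def TensorInvariant (T : n → n → n → n → ℂ) : Prop :=
  ∀ v ∈ Matrix.unitaryGroup n ℂ, ∀ b₁ b₂ a₁ a₂,
    T b₁ b₂ a₁ a₂ = ∑ d₁, ∑ d₂, ∑ e₁, ∑ e₂,
      v d₁ b₁ * v d₂ b₂ * star (v e₁ a₁) * star (v e₂ a₂) * T d₁ d₂ e₁ e₂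

lemma TensorInvariant.diagonal {T : n → n → n → n → ℂ} (hT : TensorInvariant T)
    (z : n → ℂ) (hz : ∀ i, z i * star (z i) = 1) (b₁ b₂ a₁ a₂ : n) :
    T b₁ b₂ a₁ a₂ = z b₁ * z b₂ * star (z a₁) * star (z a₂) * T b₁ b₂ a₁ a₂ := by
  have hv : Matrix.diagonal z ∈ Matrix.unitaryGroup n ℂ := by
    rw [Matrix.mem_unitaryGroup_iff, Matrix.star_eq_conjTranspose, Matrix.diagonal_conjTranspose,
      Matrix.diagonal_mul_diagonal, ← Matrix.diagonal_one]
    congr 1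
    funext i
    exact hz i
  have key := hT _ hv b₁ b₂ a₁ a₂
  simpa [Matrix.diagonal_apply, ite_mul, mul_ite, apply_ite, Finset.sum_ite_eq',
    Finset.sum_ite_eq] using key

lemma TensorInvariant.perm {T : n → n → n → n → ℂ} (hT : TensorInvariant T)
    (π : Equiv.Perm n) (b₁ b₂ a₁ a₂ : n) :
    T b₁ b₂ a₁ a₂ = T (π b₁) (π b₂) (π a₁) (π a₂) := by
  have hv : (Matrix.of fun d b => if d = π b then (1 : ℂ) else 0) ∈ Matrix.unitaryGroup n ℂ := by
    rw [Matrix.mem_unitaryGroup_iff']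
    ext i j
    simp [Matrix.mul_apply, Matrix.star_apply, Matrix.one_apply, eq_comm, apply_ite]
  have key := hT _ hv b₁ b₂ a₁ a₂
  simpa [ite_mul, mul_ite, apply_ite, Finset.sum_ite_eq', Finset.sum_ite_eq] using key

lemma sum_two_support {i j : n} (hij : i ≠ j) (f : n → ℂ) (x y : ℂ) :
    ∑ d, (if d = i then x else if d = j then y else 0) * f d = x * f i + y * f j := by
  have : ∀ d, (if d = i then x else if d = j then y else 0) * f d
      = (if d = i then x * f d else 0) + (if d = j then y * f d else 0) := by
    intro d
    by_cases h1 : d = i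
    · subst h1; simp [hij]
    · by_cases h2 : d = j
      · subst h2; simp [hij.symm]
      · simp [h1, h2]
  simp_rw [this, Finset.sum_add_distrib]
  simp

/-- A diagonal unitary with phase i at one well-chosen index multiplies the entry by i or -1, never
by 1. The phase -1 would not do, because it squares to 1 when b₁ = b₂. -/
lemma TensorInvariant.eq_zero {T : n → n → n → n → ℂ} (hT : TensorInvariant T)
    (b₁ b₂ a₁ a₂ : n) (h₁ : ¬ (b₁ = a₁ ∧ b₂ = a₂)) (h₂ : ¬ (b₁ = a₂ ∧ b₂ = a₁)) :
    T b₁ b₂ a₁ a₂ = 0 := by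
  have key := fun i => hT.diagonal (fun k => if k = i then Complex.I else 1)
    (fun k => by by_cases h : k = i <;> simp [h]) b₁ b₂ a₁ a₂
  have aux : ∀ w : ℂ, w ≠ 1 → ∀ t : ℂ, t = w * t → t = 0 := by
    intro w hw t ht
    have : (1 - w) * t = 0 := by linear_combination ht
    exact (mul_eq_zero.mp this).resolve_left (sub_ne_zero.mpr hw.symm)
  have hI : Complex.I ≠ 1 := fun h => by simpa using congrArg Complex.im h
  have hI2 : (-1 : ℂ) ≠ 1 := by norm_num
  by_cases h3 : b₁ = a₁
  · subst h3
    have h4 : ¬ b₂ = a₂ := fun h => h₁ ⟨rfl, h⟩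
    have := key b₂
    refine aux Complex.I hI _ (this.trans ?_)
    have h5 : ¬ a₂ = b₂ := fun h => h4 h.symm
    by_cases h6 : b₁ = b₂ <;> simp [h5, h6]
  · by_cases h4 : b₁ = a₂
    · subst h4
      have h4 : ¬ b₂ = a₁ := fun h => h₂ ⟨rfl, h⟩
      have := key b₂
      refine aux Complex.I hI _ (this.trans ?_)
      have h5 : ¬ a₁ = b₂ := fun h => h4 h.symm
      by_cases h6 : b₁ = b₂ <;> simp [h5, h6]
    · have := key b₁
      have h5 : ¬ a₁ = b₁ := fun h => h3 h.symm
      have h6 : ¬ a₂ = b₁ := fun h => h4 h.symm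
      by_cases h7 : b₂ = b₁
      · exact aux (-1) hI2 _ (this.trans (by simp [h5, h6, h7]))
      · exact aux Complex.I hI _ (this.trans (by simp [h5, h6, h7]))

/-- Phases and permutations leave three orbit values T_iiii, T_ijij, T_ijji; a rotation in the plane
of i and j relates them. The angle with cosine 3/5 and sine 4/5 keeps all entries rational. -/
lemma TensorInvariant.rotation {T : n → n → n → n → ℂ} (hT : TensorInvariant T)
    {i j : n} (hij : i ≠ j) :
    T i i i i = T i j i j + T i j j i := by
  have hji := hij.symm
  let c : n → n → ℂ := fun b d =>
    if b = i then (if d = i then (3 / 5 : ℂ) else if d = j then (4 / 5 : ℂ) else 0)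
    else if b = j then (if d = i then (-4 / 5 : ℂ) else if d = j then (3 / 5 : ℂ) else 0)
    else if d = b then 1 else 0
  have hi : ∀ d, c i d = if d = i then (3 / 5 : ℂ) else if d = j then (4 / 5 : ℂ) else 0 := by
    intro d; simp [c]
  have hj : ∀ d, c j d = if d = i then (-4 / 5 : ℂ) else if d = j then (3 / 5 : ℂ) else 0 := by
    intro d; simp [c, hji]
  have hk : ∀ k, k ≠ i → k ≠ j → ∀ d, c k d = if d = k then 1 else 0 := by
    intro k h1 h2 d; simp [c, h1, h2]
  have hs : ∀ k d, star (c k d) = c k d := by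
    intro k d
    simp only [c]
    split_ifs <;> simp
  have hv : (Matrix.of fun d b => c b d) ∈ Matrix.unitaryGroup n ℂ := by
    rw [Matrix.mem_unitaryGroup_iff']
    ext k l
    simp only [Matrix.mul_apply, Matrix.star_apply, Matrix.of_apply, Matrix.one_apply, hs]
    by_cases hki : k = i
    · subst hki
      simp_rw [hi, sum_two_support hij]
      by_cases hl : l = k
      · subst hl; rw [hi, hi]; simp [hji]; norm_num
      · by_cases hl' : l = j
        · subst hl'; rw [hj, hj]; simp [hij, hji]; norm_num
        · rw [hk l hl hl', hk l hl hl']; simp [Ne.symm hl, Ne.symm hl']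
    · by_cases hkj : k = j
      · subst hkj
        simp_rw [hj, sum_two_support hij]
        by_cases hl : l = i
        · subst hl; rw [hi, hi]; simp [hji]; norm_num
        · by_cases hl' : l = k
          · subst hl'; rw [hj, hj]; simp [hki]; norm_num
          · rw [hk l hl hl', hk l hl hl']; simp [Ne.symm hl, Ne.symm hl']
      · simp only [hk k hki hkj, ite_mul, one_mul, zero_mul, Finset.sum_ite_eq', Finset.mem_univ,
          if_true]
        by_cases hl : l = i
        · subst hl; rw [hi]; simp [hki, hkj]
        · by_cases hl' : l = j
          · subst hl'; rw [hj]; simp [hki, hkj]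
          · rw [hk l hl hl']
  have key := hT _ hv i i i i
  simp only [Matrix.of_apply, mul_assoc, ← Finset.mul_sum, hs] at key
  simp only [hi, sum_two_support hij] at key
  have e : ∀ k₁ k₂ k₃ k₄, ¬ (k₁ = k₃ ∧ k₂ = k₄) → ¬ (k₁ = k₄ ∧ k₂ = k₃) → T k₁ k₂ k₃ k₄ = 0 :=
    fun _ _ _ _ => hT.eq_zero _ _ _ _
  have p1 := hT.perm (Equiv.swap i j) i i i i
  have p2 := hT.perm (Equiv.swap i j) i j i j
  have p3 := hT.perm (Equiv.swap i j) i j j i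
  simp only [Equiv.swap_apply_left, Equiv.swap_apply_right] at p1 p2 p3
  rw [e i i i j (by simp [hij]) (by simp [hij]), e i i j i (by simp [hij]) (by simp [hij]),
    e i i j j (by simp [hij]) (by simp [hij]), e i j i i (by simp [hji]) (by simp [hji]),
    e i j j j (by simp [hij]) (by simp [hij]), e j i i i (by simp [hji]) (by simp [hji]),
    e j i j j (by simp [hij]) (by simp [hij]), e j j i i (by simp [hji]) (by simp [hji]),
    e j j i j (by simp [hji]) (by simp [hji]), e j j j i (by simp [hji]) (by simp [hji]),
    ← p1, ← p2, ← p3] at key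
  -- With c = 3/5 and s = 4/5 the relation reads (1 - c⁴ - s⁴) T_iiii = 2c²s² (T_ijij + T_ijji), and
  -- both prefactors equal 288/625.
  linear_combination (625 / 288) * key

lemma exists_perm_pair {n : Type*} [DecidableEq n] {i j k l : n} (hij : i ≠ j) (hkl : k ≠ l) :
    ∃ π : Equiv.Perm n, π i = k ∧ π j = l := by
  refine ⟨Equiv.swap (Equiv.swap i k j) l * Equiv.swap i k, ?_, ?_⟩
  · rw [Equiv.Perm.mul_apply, Equiv.swap_apply_left]
    refine Equiv.swap_apply_of_ne_of_ne ?_ hkl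
    intro h
    have := (Equiv.swap i k).injective ((Equiv.swap_apply_left i k).trans h)
    exact hij this
  · rw [Equiv.Perm.mul_apply, Equiv.swap_apply_left]

/-- Invariant tensors are combinations of the identity and the swap. -/
lemma TensorInvariant.exists_eq {T : n → n → n → n → ℂ} (hT : TensorInvariant T) :
    ∃ α β : ℂ, ∀ b₁ b₂ a₁ a₂, T b₁ b₂ a₁ a₂
      = α * (if b₁ = a₁ ∧ b₂ = a₂ then 1 else 0) + β * (if b₁ = a₂ ∧ b₂ = a₁ then 1 else 0) := by
  by_cases hn : ∃ i j : n, i ≠ j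
  · obtain ⟨i, j, hij⟩ := hn
    refine ⟨T i j i j, T i j j i, fun b₁ b₂ a₁ a₂ => ?_⟩
    by_cases hb : b₁ = b₂
    · subst hb
      by_cases ha : b₁ = a₁ ∧ b₁ = a₂
      · obtain ⟨rfl, rfl⟩ := ha
        rw [hT.perm (Equiv.swap b₁ i)]
        simp [hT.rotation hij]
      · rw [hT.eq_zero _ _ _ _ (by tauto) (by tauto)]
        rw [if_neg (by tauto), if_neg (by tauto)]; ring
    · by_cases h1 : b₁ = a₁ ∧ b₂ = a₂
      · obtain ⟨rfl, rfl⟩ := h1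
        obtain ⟨π, rfl, rfl⟩ := exists_perm_pair hij hb
        rw [← hT.perm π]
        simp [hij]
      · by_cases h2 : b₁ = a₂ ∧ b₂ = a₁
        · obtain ⟨rfl, rfl⟩ := h2
          obtain ⟨π, rfl, rfl⟩ := exists_perm_pair hij hb
          rw [← hT.perm π]
          simp [hij]
        · rw [hT.eq_zero _ _ _ _ h1 h2, if_neg h1, if_neg h2]; ring
  · push Not at hn
    rcases isEmpty_or_nonempty n with h | ⟨⟨i⟩⟩
    · exact ⟨0, 0, fun b => h.elim b⟩
    -- In dimension one identity and swap coincide, so the split of the coefficients is arbitrary.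
    · refine ⟨T i i i i, 0, fun b₁ b₂ a₁ a₂ => ?_⟩
      rw [hn b₁ i, hn b₂ i, hn a₁ i, hn a₂ i]; simp

end Commutant

/-! ### Two replicas averaged over one gate -/

instance instIsHaarMeasureHaarGate (q : ℕ) : (haarGate q).IsHaarMeasure := by
  unfold haarGate; infer_instance

instance instSecondCountableTopologyGate (q : ℕ) : SecondCountableTopology (Gate q) := by
  have h : SecondCountableTopology (Matrix (Fin q × Fin q) (Fin q × Fin q) ℂ) :=
    inferInstanceAs (SecondCountableTopology (Fin q × Fin q → Fin q × Fin q → ℂ))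
  exact TopologicalSpace.Subtype.secondCountableTopology _

/-- A right translate of a left Haar measure is a left Haar measure, and a probability one is
unique. -/
lemma map_mul_right_haarGate {q : ℕ} (v : Gate q) :
    (haarGate q).map (· * v) = haarGate q := by
  have h1 : IsProbabilityMeasure ((haarGate q).map (· * v)) :=
    Measure.isProbabilityMeasure_map (by fun_prop)
  exact Measure.isHaarMeasure_eq_of_isProbabilityMeasure _ _

/-- The kernel of a pair gate on two replicas that are exchanged as prescribed by `m`. -/
def replicaKernel {P : Type*} [Fintype P] (m : P → P → P) (g : Matrix P P ℂ)
    (b₁ b₂ a₁ a₂ : P) : ℂ :=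
  ∑ c₁, ∑ c₂, g c₁ b₁ * g c₂ b₂ * star (g (m c₂ c₁) a₁) * star (g (m c₁ c₂) a₂)

section Kernel

variable {P : Type*} [Fintype P]

lemma sum_four_comm {R : Type*} [Fintype R] (F : P → P → P → P → R → ℂ) :
    ∑ d₁, ∑ d₂, ∑ e₁, ∑ e₂, ∑ c, F d₁ d₂ e₁ e₂ c = ∑ c, ∑ d₁, ∑ d₂, ∑ e₁, ∑ e₂, F d₁ d₂ e₁ e₂ c := by
  rw [Finset.sum_comm (s := Finset.univ (α := R)) (t := Finset.univ) (f := fun c d₁ =>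
    ∑ d₂, ∑ e₁, ∑ e₂, F d₁ d₂ e₁ e₂ c)]
  refine Finset.sum_congr rfl fun d₁ _ => ?_
  rw [Finset.sum_comm (s := Finset.univ (α := R)) (t := Finset.univ) (f := fun c d₂ =>
    ∑ e₁, ∑ e₂, F d₁ d₂ e₁ e₂ c)]
  refine Finset.sum_congr rfl fun d₂ _ => ?_
  rw [Finset.sum_comm (s := Finset.univ (α := R)) (t := Finset.univ) (f := fun c e₁ =>
    ∑ e₂, F d₁ d₂ e₁ e₂ c)]
  exact Finset.sum_congr rfl fun e₁ _ => Finset.sum_comm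

lemma sum_two_comm {P R : Type*} [Fintype P] [Fintype R] (F : P → P → R → R → ℂ) :
    ∑ b₁, ∑ b₂, ∑ c₁, ∑ c₂, F b₁ b₂ c₁ c₂ = ∑ c₁, ∑ c₂, ∑ b₁, ∑ b₂, F b₁ b₂ c₁ c₂ := by
  have h := Finset.sum_comm (s := Finset.univ (α := P × P)) (t := Finset.univ (α := R × R))
    (f := fun b c => F b.1 b.2 c.1 c.2)
  simpa only [Fintype.sum_prod_type] using h

lemma mul_sum_four (A B C D : P → ℂ) :
    (∑ d, A d) * (∑ d, B d) * (∑ d, C d) * (∑ d, D d)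
      = ∑ d₁, ∑ d₂, ∑ e₁, ∑ e₂, A d₁ * B d₂ * C e₁ * D e₂ := by
  simp only [← Finset.mul_sum, ← Finset.sum_mul]

/-- Right translation of the gate by v conjugates the tensor; with right invariance of Haar measure
this makes the averaged kernel a `TensorInvariant`. -/
lemma replicaKernel_mul (m : P → P → P) (g v : Matrix P P ℂ) (b₁ b₂ a₁ a₂ : P) :
    replicaKernel m (g * v) b₁ b₂ a₁ a₂ = ∑ d₁, ∑ d₂, ∑ e₁, ∑ e₂,
      v d₁ b₁ * v d₂ b₂ * star (v e₁ a₁) * star (v e₂ a₂) * replicaKernel m g d₁ d₂ e₁ e₂ := by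
  have h : ∀ c₁ c₂, (g * v) c₁ b₁ * (g * v) c₂ b₂ * star ((g * v) (m c₂ c₁) a₁)
      * star ((g * v) (m c₁ c₂) a₂) = ∑ d₁, ∑ d₂, ∑ e₁, ∑ e₂,
        v d₁ b₁ * v d₂ b₂ * star (v e₁ a₁) * star (v e₂ a₂) *
          (g c₁ d₁ * g c₂ d₂ * star (g (m c₂ c₁) e₁) * star (g (m c₁ c₂) e₂)) := by
    intro c₁ c₂
    simp only [Matrix.mul_apply, star_sum, star_mul']
    rw [mul_sum_four]
    refine Finset.sum_congr rfl fun d₁ _ => Finset.sum_congr rfl fun d₂ _ =>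
      Finset.sum_congr rfl fun e₁ _ => Finset.sum_congr rfl fun e₂ _ => ?_
    ring
  simp only [replicaKernel, h, Finset.mul_sum]
  exact (Finset.sum_congr rfl fun c₁ _ => (sum_four_comm _).symm).trans (sum_four_comm _).symm

lemma sum_mul_star_of_unitary [DecidableEq P] {g : Matrix P P ℂ}
    (hg : g ∈ Matrix.unitaryGroup P ℂ) (c d : P) :
    ∑ b, g c b * star (g d b) = if c = d then 1 else 0 := by
  have := congrFun (congrFun (Matrix.mem_unitaryGroup_iff.mp hg) c) d
  simpa [Matrix.mul_apply, Matrix.star_apply, Matrix.one_apply] using this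

/-- Closing each replica on itself cancels the gates by unitarity. What remains counts the pairs
that the exchange leaves unchanged, which determines the coefficients in the average. -/
lemma replicaKernel_trace [DecidableEq P] (m : P → P → P) {g : Matrix P P ℂ}
    (hg : g ∈ Matrix.unitaryGroup P ℂ) :
    ∑ b₁, ∑ b₂, replicaKernel m g b₁ b₂ b₁ b₂
      = ∑ c₁, ∑ c₂, (if c₁ = m c₂ c₁ then 1 else 0) * (if c₂ = m c₁ c₂ then 1 else 0) := by
  simp only [replicaKernel]
  simp only [← sum_mul_star_of_unitary hg, Finset.sum_mul_sum]
  rw [sum_two_comm]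
  refine Finset.sum_congr rfl fun c₁ _ => Finset.sum_congr rfl fun c₂ _ =>
    Finset.sum_congr rfl fun b₁ _ => Finset.sum_congr rfl fun b₂ _ => ?_
  ring

lemma replicaKernel_swap (m : P → P → P) (g : Matrix P P ℂ) (b₁ b₂ a₁ a₂ : P) :
    replicaKernel m g b₁ b₂ a₂ a₁ = replicaKernel (fun c d => m d c) g b₁ b₂ a₁ a₂ := by
  simp only [replicaKernel]
  refine Finset.sum_congr rfl fun c₁ _ => Finset.sum_congr rfl fun c₂ _ => ?_
  ring

lemma sum_star_mul_of_unitary [DecidableEq P] {g : Matrix P P ℂ}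
    (hg : g ∈ Matrix.unitaryGroup P ℂ) (c d : P) :
    ∑ b, g b c * star (g b d) = if c = d then 1 else 0 := by
  have := congrFun (congrFun (Matrix.mem_unitaryGroup_iff'.mp hg) d) c
  simp only [Matrix.mul_apply, Matrix.star_apply, Matrix.one_apply] at this
  simp only [eq_comm (a := c), ← this, mul_comm]

/-- When neither site of the pair is exchanged, unitarity evaluates the kernel for every single
gate, without averaging. -/
lemma replicaKernel_keep [DecidableEq P] {g : Matrix P P ℂ} (hg : g ∈ Matrix.unitaryGroup P ℂ)
    (b₁ b₂ a₁ a₂ : P) :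
    replicaKernel (fun _ d => d) g b₁ b₂ a₁ a₂
      = (if b₁ = a₁ then 1 else 0) * (if b₂ = a₂ then 1 else 0) := by
  simp only [replicaKernel, ← sum_star_mul_of_unitary hg, Finset.sum_mul_sum]
  refine Finset.sum_congr rfl fun c₁ _ => Finset.sum_congr rfl fun c₂ _ => ?_
  ring

lemma replicaKernel_exchange [DecidableEq P] {g : Matrix P P ℂ}
    (hg : g ∈ Matrix.unitaryGroup P ℂ) (b₁ b₂ a₁ a₂ : P) :
    replicaKernel (fun c _ => c) g b₁ b₂ a₁ a₂
      = (if b₁ = a₂ then 1 else 0) * (if b₂ = a₁ then 1 else 0) := by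
  rw [← replicaKernel_keep hg, ← replicaKernel_swap]

end Kernel

/-- The factor `q / (q² + 1)` of a gate across an end point. -/
def cutWeight (q : ℕ) : ℝ := (q : ℝ) / ((q : ℝ) ^ 2 + 1)

lemma continuous_gate_apply {q : ℕ} (a b : Fin q × Fin q) :
    Continuous fun g : Gate q => (g : Matrix (Fin q × Fin q) (Fin q × Fin q) ℂ) a b :=
  (continuous_apply_apply a b).comp continuous_subtype_val

lemma continuous_replicaKernel {q : ℕ} (m : Fin q × Fin q → Fin q × Fin q → Fin q × Fin q)
    (b₁ b₂ a₁ a₂ : Fin q × Fin q) :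
    Continuous fun g : Gate q => replicaKernel m g.1 b₁ b₂ a₁ a₂ := by
  unfold replicaKernel
  refine continuous_finsetSum _ fun c₁ _ => continuous_finsetSum _ fun c₂ _ => ?_
  exact (((continuous_gate_apply _ _).mul (continuous_gate_apply _ _)).mul
    (continuous_gate_apply _ _).star).mul (continuous_gate_apply _ _).star

lemma integrable_of_continuous {X E : Type*} [TopologicalSpace X] [CompactSpace X]
    [MeasurableSpace X] [OpensMeasurableSpace X] [NormedAddCommGroup E]
    [SecondCountableTopologyEither X E]
    {μ : Measure X} [IsFiniteMeasure μ] {f : X → E} (hf : Continuous f) : Integrable f μ :=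
  hf.integrable_of_hasCompactSupport (HasCompactSupport.of_compactSpace f)

lemma integrable_replicaKernel {q : ℕ} (m : Fin q × Fin q → Fin q × Fin q → Fin q × Fin q)
    (b₁ b₂ a₁ a₂ : Fin q × Fin q) :
    Integrable (fun g : Gate q => replicaKernel m g.1 b₁ b₂ a₁ a₂) (haarGate q) :=
  integrable_of_continuous (continuous_replicaKernel m b₁ b₂ a₁ a₂)

lemma tensorInvariant_integral_replicaKernel {q : ℕ}
    (m : Fin q × Fin q → Fin q × Fin q → Fin q × Fin q) :
    TensorInvariant fun b₁ b₂ a₁ a₂ =>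
      ∫ g : Gate q, replicaKernel m g.1 b₁ b₂ a₁ a₂ ∂(haarGate q) := by
  intro v hv b₁ b₂ a₁ a₂
  have h1 : ∫ g : Gate q, replicaKernel m g.1 b₁ b₂ a₁ a₂ ∂(haarGate q)
      = ∫ g : Gate q, replicaKernel m (g.1 * v) b₁ b₂ a₁ a₂ ∂(haarGate q) := by
    conv_lhs => rw [← map_mul_right_haarGate (⟨v, hv⟩ : Gate q)]
    rw [integral_map (by fun_prop)
      (continuous_replicaKernel m b₁ b₂ a₁ a₂).aestronglyMeasurable]
    rfl
  have hi : ∀ d₁ d₂ e₁ e₂, Integrable (fun g : Gate q =>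
      v d₁ b₁ * v d₂ b₂ * star (v e₁ a₁) * star (v e₂ a₂) * replicaKernel m g.1 d₁ d₂ e₁ e₂)
      (haarGate q) := fun d₁ d₂ e₁ e₂ => (integrable_replicaKernel m d₁ d₂ e₁ e₂).const_mul _
  simp only [h1, replicaKernel_mul]
  rw [integral_finsetSum _ fun d₁ _ => integrable_finsetSum _ fun d₂ _ =>
    integrable_finsetSum _ fun e₁ _ => integrable_finsetSum _ fun e₂ _ => hi d₁ d₂ e₁ e₂]
  refine Finset.sum_congr rfl fun d₁ _ => ?_
  rw [integral_finsetSum _ fun d₂ _ =>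
    integrable_finsetSum _ fun e₁ _ => integrable_finsetSum _ fun e₂ _ => hi d₁ d₂ e₁ e₂]
  refine Finset.sum_congr rfl fun d₂ _ => ?_
  rw [integral_finsetSum _ fun e₁ _ => integrable_finsetSum _ fun e₂ _ => hi d₁ d₂ e₁ e₂]
  refine Finset.sum_congr rfl fun e₁ _ => ?_
  rw [integral_finsetSum _ fun e₂ _ => hi d₁ d₂ e₁ e₂]
  exact Finset.sum_congr rfl fun e₂ _ => integral_const_mul _ _

/-- A gate across an end point averages to the mean of removing and adding the pair. -/
lemma integral_replicaKernel_right {q : ℕ} (hq : 1 ≤ q) (b₁ b₂ a₁ a₂ : Fin q × Fin q) :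
    ∫ g : Gate q, replicaKernel (fun c d => (d.1, c.2)) g.1 b₁ b₂ a₁ a₂ ∂(haarGate q)
      = cutWeight q * ((if b₁ = a₁ then 1 else 0) * (if b₂ = a₂ then 1 else 0)
        + (if b₁ = a₂ then 1 else 0) * (if b₂ = a₁ then 1 else 0)) := by
  obtain ⟨α, β, h⟩ := (tensorInvariant_integral_replicaKernel
    (fun c d : Fin q × Fin q => (d.1, c.2))).exists_eq
  have hq0 : (q : ℂ) ≠ 0 := by exact_mod_cast (by omega : q ≠ 0)
  -- The fixed pairs are those whose second components agree: q³ of them. For the swapped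
  -- contraction below it is the first components.
  have t1 : ∑ b₁, ∑ b₂, ∫ g : Gate q,
      replicaKernel (fun c d => (d.1, c.2)) g.1 b₁ b₂ b₁ b₂ ∂(haarGate q) = (q : ℂ) ^ 3 := by
    simp_rw [← integral_finsetSum Finset.univ fun b _ => integrable_replicaKernel _ _ b _ b]
    rw [← integral_finsetSum _ fun b _ => integrable_finsetSum _ fun c _ =>
      integrable_replicaKernel _ b c b c]
    simp only [replicaKernel_trace _ (Subtype.property _)]
    simp [Prod.ext_iff, Fintype.sum_prod_type, eq_comm]
    ring
  have t2 : ∑ b₁, ∑ b₂, ∫ g : Gate q,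
      replicaKernel (fun c d => (d.1, c.2)) g.1 b₁ b₂ b₂ b₁ ∂(haarGate q) = (q : ℂ) ^ 3 := by
    have hs : ∀ (g : Matrix (Fin q × Fin q) (Fin q × Fin q) ℂ) (b₁ b₂ : Fin q × Fin q),
        replicaKernel (fun c d => (d.1, c.2)) g b₁ b₂ b₂ b₁
          = replicaKernel (fun c d => (c.1, d.2)) g b₁ b₂ b₁ b₂ :=
      fun g b₁ b₂ => replicaKernel_swap _ g b₁ b₂ b₁ b₂
    simp only [hs]
    simp_rw [← integral_finsetSum Finset.univ fun b _ => integrable_replicaKernel _ _ b _ b]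
    rw [← integral_finsetSum _ fun b _ => integrable_finsetSum _ fun c _ =>
      integrable_replicaKernel _ b c b c]
    simp only [replicaKernel_trace _ (Subtype.property _)]
    simp [Prod.ext_iff, Fintype.sum_prod_type, eq_comm]
    ring
  have s1 : ∑ b₁ : Fin q × Fin q, ∑ b₂ : Fin q × Fin q, (1 : ℂ) = (q : ℂ) ^ 4 := by
    simp; ring
  have s2 : ∑ b₁ : Fin q × Fin q, ∑ b₂ : Fin q × Fin q,
      (if b₁ = b₂ ∧ b₂ = b₁ then (1 : ℂ) else 0) = (q : ℂ) ^ 2 := by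
    have : ∀ b₁ b₂ : Fin q × Fin q, (b₁ = b₂ ∧ b₂ = b₁) ↔ b₁ = b₂ := fun _ _ =>
      ⟨And.left, fun h => ⟨h, h.symm⟩⟩
    simp only [this]
    simp; ring
  simp only [h, Finset.sum_add_distrib, ← Finset.mul_sum, and_self, if_true, s1, s2] at t1 t2
  have hw : (cutWeight q : ℂ) * ((q : ℂ) ^ 2 + 1) = q := by
    have : (cutWeight q) * ((q : ℝ) ^ 2 + 1) = q := by
      unfold cutWeight; field_simp
    exact_mod_cast congrArg (fun x : ℝ => (x : ℂ)) this
  have e1 : α * (q : ℂ) ^ 2 + β = q := by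
    have : (q : ℂ) ^ 2 * (α * (q : ℂ) ^ 2 + β) = (q : ℂ) ^ 2 * q := by linear_combination t1
    exact mul_left_cancel₀ (pow_ne_zero 2 hq0) this
  have e2 : α + β * (q : ℂ) ^ 2 = q := by
    have : (q : ℂ) ^ 2 * (α + β * (q : ℂ) ^ 2) = (q : ℂ) ^ 2 * q := by linear_combination t2
    exact mul_left_cancel₀ (pow_ne_zero 2 hq0) this
  have hp : ((q : ℂ) ^ 2 + 1) ≠ 0 := by
    have : ((q ^ 2 + 1 : ℕ) : ℂ) ≠ 0 := Nat.cast_ne_zero.mpr (by omega)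
    exact_mod_cast this
  have e3 : α + β = 2 * cutWeight q := by
    apply mul_right_cancel₀ hp
    linear_combination e1 + e2 - 2 * hw
  rw [h]
  rcases Nat.lt_or_ge 1 q with h1 | h1
  · have hm : ((q : ℂ) ^ 2 - 1) ≠ 0 := by
      have : ((q ^ 2 : ℕ) : ℂ) ≠ (1 : ℕ) := fun h => by
        have := Nat.cast_injective h
        nlinarith
      exact sub_ne_zero.mpr (by exact_mod_cast this)
    have e4 : α = β := by
      apply mul_right_cancel₀ hm
      linear_combination e1 - e2
    subst e4
    have e5 : α = cutWeight q := by linear_combination e3 / 2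
    rw [e5]
    rw [ite_zero_mul_ite_zero, ite_zero_mul_ite_zero, mul_one, mul_add]
  -- For q = 1 identity and swap are equal, and only the sum α + β is determined, which is all that
  -- is needed.
  · obtain rfl : q = 1 := le_antisymm h1 hq
    have : ∀ x y : Fin 1 × Fin 1, x = y := fun x y => Subsingleton.elim x y
    simp only [this b₁ a₁, this b₂ a₂, this a₁ a₂, and_self, if_true]
    linear_combination e3

lemma integral_replicaKernel_left {q : ℕ} (hq : 1 ≤ q) (b₁ b₂ a₁ a₂ : Fin q × Fin q) :
    ∫ g : Gate q, replicaKernel (fun c d => (c.1, d.2)) g.1 b₁ b₂ a₁ a₂ ∂(haarGate q)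
      = cutWeight q * ((if b₁ = a₁ then 1 else 0) * (if b₂ = a₂ then 1 else 0)
        + (if b₁ = a₂ then 1 else 0) * (if b₂ = a₁ then 1 else 0)) := by
  rw [add_comm, ← integral_replicaKernel_right hq b₁ b₂ a₂ a₁]
  exact integral_congr_ae (.of_forall fun g => (replicaKernel_swap _ g.1 b₁ b₂ a₁ a₂).symm)

/-! ### Purities as swap expectation values -/

/-- The expectation value in `ρ ⊗ ρ` of the exchange of the two replicas prescribed by `m`. -/
def swapPurity {C : Type*} [Fintype C] (m : C → C → C) (ρ : Matrix C C ℂ) : ℂ :=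
  ∑ s₁, ∑ s₂, ρ s₁ (m s₂ s₁) * ρ s₂ (m s₁ s₂)

lemma swapPurity_equiv {C D : Type*} [Fintype C] [Fintype D] (e : C ≃ D) {m : C → C → C}
    {m' : D → D → D} (h : ∀ x y, e (m x y) = m' (e x) (e y)) (ρ : Matrix C C ℂ) :
    swapPurity m ρ = swapPurity m' (ρ.submatrix e.symm e.symm) := by
  simp only [swapPurity, Matrix.submatrix_apply]
  rw [← e.sum_comp]
  refine Finset.sum_congr rfl fun s₁ _ => ?_
  rw [← e.sum_comp]
  refine Finset.sum_congr rfl fun s₂ _ => ?_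
  simp [← h]

section Prod

open scoped Kronecker

variable {P R : Type*} [Fintype P] [Fintype R]

/-- The exchange that acts as `m` on the first and as `k` on the second factor. -/
def prodMix (m : P → P → P) (k : R → R → R) (x y : P × R) : P × R := (m x.1 y.1, k x.2 y.2)

/-- The partial contraction of two replicas over the second factor. -/
def replicaBlock (k : R → R → R) (ρ : Matrix (P × R) (P × R) ℂ) (b₁ b₂ a₁ a₂ : P) : ℂ :=
  ∑ r₁, ∑ r₂, ρ (b₁, r₁) (a₁, k r₂ r₁) * ρ (b₂, r₂) (a₂, k r₁ r₂)

lemma swapPurity_prodMix_keep (k : R → R → R) (ρ : Matrix (P × R) (P × R) ℂ) :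
    swapPurity (prodMix (fun _ d => d) k) ρ = ∑ b₁, ∑ b₂, replicaBlock k ρ b₁ b₂ b₁ b₂ := by
  simp only [swapPurity, Fintype.sum_prod_type, prodMix, replicaBlock]
  exact Finset.sum_congr rfl fun c₁ _ => Finset.sum_comm

lemma swapPurity_prodMix_exchange (k : R → R → R) (ρ : Matrix (P × R) (P × R) ℂ) :
    swapPurity (prodMix (fun c _ => c) k) ρ = ∑ b₁, ∑ b₂, replicaBlock k ρ b₁ b₂ b₂ b₁ := by
  simp only [swapPurity, Fintype.sum_prod_type, prodMix, replicaBlock]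
  exact Finset.sum_congr rfl fun c₁ _ => Finset.sum_comm

variable [DecidableEq R]

lemma kronecker_one_conj_apply (g : Matrix P P ℂ) (ρ : Matrix (P × R) (P × R) ℂ)
    (c c' : P) (r r' : R) :
    ((g ⊗ₖ (1 : Matrix R R ℂ)) * ρ * (g ⊗ₖ (1 : Matrix R R ℂ)).conjTranspose) (c, r) (c', r')
      = ∑ b, ∑ a, g c b * ρ (b, r) (a, r') * star (g c' a) := by
  simp only [Matrix.mul_apply, Fintype.sum_prod_type, Matrix.kroneckerMap_apply,
    Matrix.conjTranspose_apply, Matrix.one_apply, mul_ite, mul_one, mul_zero, ite_mul, zero_mul,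
    Finset.sum_ite_eq, Finset.mem_univ, if_true, apply_ite star, star_zero, Finset.sum_mul]
  rw [Finset.sum_comm]

/-- Separates the gate from the state, so that an average over g acts on `replicaKernel` alone. -/
lemma swapPurity_kronecker_conj (m : P → P → P) (k : R → R → R) (g : Matrix P P ℂ)
    (ρ : Matrix (P × R) (P × R) ℂ) :
    swapPurity (prodMix m k)
        ((g ⊗ₖ (1 : Matrix R R ℂ)) * ρ * (g ⊗ₖ (1 : Matrix R R ℂ)).conjTranspose)
      = ∑ b₁, ∑ b₂, ∑ a₁, ∑ a₂, replicaKernel m g b₁ b₂ a₁ a₂ * replicaBlock k ρ b₁ b₂ a₁ a₂ := by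
  have h : ∀ c₁ r₁ c₂ r₂,
      (∑ b, ∑ a, g c₁ b * ρ (b, r₁) (a, k r₂ r₁) * star (g (m c₂ c₁) a))
        * (∑ b, ∑ a, g c₂ b * ρ (b, r₂) (a, k r₁ r₂) * star (g (m c₁ c₂) a))
      = ∑ b₁, ∑ b₂, ∑ a₁, ∑ a₂,
        g c₁ b₁ * g c₂ b₂ * star (g (m c₂ c₁) a₁) * star (g (m c₁ c₂) a₂)
          * (ρ (b₁, r₁) (a₁, k r₂ r₁) * ρ (b₂, r₂) (a₂, k r₁ r₂)) := by
    intro c₁ r₁ c₂ r₂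
    simp only [Finset.sum_mul_sum]
    refine Finset.sum_congr rfl fun b₁ _ => Finset.sum_congr rfl fun b₂ _ =>
      Finset.sum_congr rfl fun a₁ _ => Finset.sum_congr rfl fun a₂ _ => ?_
    ring
  simp only [swapPurity, Fintype.sum_prod_type, prodMix, kronecker_one_conj_apply, h]
  simp only [replicaKernel, replicaBlock, Finset.sum_mul_sum]
  refine Eq.trans (Finset.sum_congr rfl fun c₁ _ => ?_) (sum_four_comm _).symm
  refine Eq.trans (Finset.sum_congr rfl fun r₁ _ => ?_) (sum_four_comm _).symm
  refine Eq.trans (Finset.sum_congr rfl fun c₂ _ => ?_) (sum_four_comm _).symm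
  exact (sum_four_comm _).symm

variable [DecidableEq P]

lemma swapPurity_keep_kronecker {g : Matrix P P ℂ} (hg : g ∈ Matrix.unitaryGroup P ℂ)
    (k : R → R → R) (ρ : Matrix (P × R) (P × R) ℂ) :
    swapPurity (prodMix (fun _ d => d) k)
        ((g ⊗ₖ (1 : Matrix R R ℂ)) * ρ * (g ⊗ₖ (1 : Matrix R R ℂ)).conjTranspose)
      = swapPurity (prodMix (fun _ d => d) k) ρ := by
  rw [swapPurity_kronecker_conj, swapPurity_prodMix_keep]
  simp [replicaKernel_keep hg]

lemma swapPurity_exchange_kronecker {g : Matrix P P ℂ} (hg : g ∈ Matrix.unitaryGroup P ℂ)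
    (k : R → R → R) (ρ : Matrix (P × R) (P × R) ℂ) :
    swapPurity (prodMix (fun c _ => c) k)
        ((g ⊗ₖ (1 : Matrix R R ℂ)) * ρ * (g ⊗ₖ (1 : Matrix R R ℂ)).conjTranspose)
      = swapPurity (prodMix (fun c _ => c) k) ρ := by
  rw [swapPurity_kronecker_conj, swapPurity_prodMix_exchange]
  simp [replicaKernel_exchange hg]

end Prod

section Average

open scoped Kronecker

variable {R : Type*} [Fintype R] [DecidableEq R] {q : ℕ}

lemma integral_swapPurity_kronecker
    {m : Fin q × Fin q → Fin q × Fin q → Fin q × Fin q}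
    (hm : ∀ b₁ b₂ a₁ a₂, ∫ g : Gate q, replicaKernel m g.1 b₁ b₂ a₁ a₂ ∂(haarGate q)
      = cutWeight q * ((if b₁ = a₁ then 1 else 0) * (if b₂ = a₂ then 1 else 0)
        + (if b₁ = a₂ then 1 else 0) * (if b₂ = a₁ then 1 else 0)))
    (k : R → R → R) (ρ : Matrix ((Fin q × Fin q) × R) ((Fin q × Fin q) × R) ℂ) :
    ∫ g : Gate q, swapPurity (prodMix m k)
        ((g.1 ⊗ₖ (1 : Matrix R R ℂ)) * ρ * (g.1 ⊗ₖ (1 : Matrix R R ℂ)).conjTranspose) ∂(haarGate q)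
      = cutWeight q * (swapPurity (prodMix (fun c _ => c) k) ρ
        + swapPurity (prodMix (fun _ d => d) k) ρ) := by
  have hi : ∀ b₁ b₂ a₁ a₂, Integrable (fun g : Gate q =>
      replicaKernel m g.1 b₁ b₂ a₁ a₂ * replicaBlock k ρ b₁ b₂ a₁ a₂) (haarGate q) :=
    fun b₁ b₂ a₁ a₂ => (integrable_replicaKernel m b₁ b₂ a₁ a₂).mul_const _
  simp only [swapPurity_kronecker_conj]
  have : ∫ g : Gate q, (∑ b₁, ∑ b₂, ∑ a₁, ∑ a₂,
        replicaKernel m g.1 b₁ b₂ a₁ a₂ * replicaBlock k ρ b₁ b₂ a₁ a₂) ∂(haarGate q)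
      = ∑ b₁, ∑ b₂, ∑ a₁, ∑ a₂, ∫ g : Gate q,
        replicaKernel m g.1 b₁ b₂ a₁ a₂ * replicaBlock k ρ b₁ b₂ a₁ a₂ ∂(haarGate q) := by
    rw [integral_finsetSum _ fun d₁ _ => integrable_finsetSum _ fun d₂ _ =>
      integrable_finsetSum _ fun e₁ _ => integrable_finsetSum _ fun e₂ _ => hi d₁ d₂ e₁ e₂]
    refine Finset.sum_congr rfl fun d₁ _ => ?_
    rw [integral_finsetSum _ fun d₂ _ =>
      integrable_finsetSum _ fun e₁ _ => integrable_finsetSum _ fun e₂ _ => hi d₁ d₂ e₁ e₂]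
    refine Finset.sum_congr rfl fun d₂ _ => ?_
    rw [integral_finsetSum _ fun e₁ _ => integrable_finsetSum _ fun e₂ _ => hi d₁ d₂ e₁ e₂]
    refine Finset.sum_congr rfl fun e₁ _ => ?_
    rw [integral_finsetSum _ fun e₂ _ => hi d₁ d₂ e₁ e₂]
  rw [this]
  have hd : ∀ b₁ b₂ a₁ a₂, (cutWeight q * ((if b₁ = a₁ then 1 else 0) * (if b₂ = a₂ then 1 else 0)
        + (if b₁ = a₂ then 1 else 0) * (if b₂ = a₁ then 1 else 0))) * replicaBlock k ρ b₁ b₂ a₁ a₂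
      = cutWeight q * ((if b₂ = a₁ then 1 else 0) * ((if b₁ = a₂ then 1 else 0)
          * replicaBlock k ρ b₁ b₂ a₁ a₂))
        + cutWeight q * ((if b₁ = a₁ then 1 else 0) * ((if b₂ = a₂ then 1 else 0)
          * replicaBlock k ρ b₁ b₂ a₁ a₂)) := fun _ _ _ _ => by ring
  simp only [integral_mul_const, hm]
  simp only [hd]
  simp only [Finset.sum_add_distrib, ← Finset.mul_sum]
  simp only [ite_mul, one_mul, zero_mul, Finset.sum_ite_eq, Finset.mem_univ, if_true]
  rw [swapPurity_prodMix_keep, swapPurity_prodMix_exchange, mul_add]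

end Average

/-! ### Pair gates on a finite set of sites -/

section Sites

open scoped Kronecker

variable {ι : Type*} [Fintype ι] [DecidableEq ι] {q : ℕ}

/-- Splits off the values at two distinct sites of a configuration. -/
def pairSplit {x y : ι} (hxy : x ≠ y) :
    (ι → Fin q) ≃ (Fin q × Fin q) × ({z : ι // z ≠ x ∧ z ≠ y} → Fin q) where
  toFun σ := ((σ x, σ y), fun z => σ z.1)
  invFun p z := if hx : z = x then p.1.1 else if hy : z = y then p.1.2 else p.2 ⟨z, hx, hy⟩
  left_inv σ := by
    funext z
    by_cases hx : z = x
    · subst hx; simp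
    · by_cases hy : z = y
      · subst hy; simp [hx]
      · simp [hx, hy]
  right_inv p := by
    refine Prod.ext (Prod.ext ?_ ?_) ?_
    · simp
    · simp [hxy.symm]
    · funext z
      simp [z.2.1, z.2.2]

/-- A gate on the sites `x, y`, acting as the identity on the other sites. -/
def pairOp {x y : ι} (hxy : x ≠ y) (g : Matrix (Fin q × Fin q) (Fin q × Fin q) ℂ) :
    Matrix (ι → Fin q) (ι → Fin q) ℂ :=
  (g ⊗ₖ (1 : Matrix ({z : ι // z ≠ x ∧ z ≠ y} → Fin q) _ ℂ)).submatrix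
    (pairSplit hxy) (pairSplit hxy)

open scoped Classical in
/-- The configuration that agrees with `σ` on `p` and with `τ` elsewhere. -/
def siteMix (p : ι → Prop) (σ τ : ι → Fin q) : ι → Fin q := fun z => if p z then σ z else τ z

/-- The purity of the reduced state on the sites satisfying `p`. -/
def sitePurity (p : ι → Prop) (ρ : Matrix (ι → Fin q) (ι → Fin q) ℂ) : ℂ :=
  swapPurity (siteMix p) ρ

lemma pairOp_conj {x y : ι} (hxy : x ≠ y) (g : Matrix (Fin q × Fin q) (Fin q × Fin q) ℂ)
    (ρ : Matrix (ι → Fin q) (ι → Fin q) ℂ) :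
    (pairOp hxy g * ρ * (pairOp hxy g).conjTranspose).submatrix
        (pairSplit hxy).symm (pairSplit hxy).symm
      = (g ⊗ₖ 1) * ρ.submatrix (pairSplit hxy).symm (pairSplit hxy).symm
        * (g ⊗ₖ 1).conjTranspose := by
  rw [← Matrix.submatrix_mul_equiv _ _ _ (pairSplit hxy).symm,
    ← Matrix.submatrix_mul_equiv _ _ _ (pairSplit hxy).symm, ← Matrix.conjTranspose_submatrix]
  simp only [pairOp, Matrix.submatrix_submatrix, Equiv.self_comp_symm, Matrix.submatrix_id_id]

/-- Passes from a set of sites to a pair times the rest; m records which of the sites x, y belong to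
the region. -/
lemma sitePurity_eq_prodMix {x y : ι} (hxy : x ≠ y) {p : ι → Prop}
    (m : Fin q × Fin q → Fin q × Fin q → Fin q × Fin q)
    (hm : ∀ σ τ : ι → Fin q, (siteMix p σ τ x, siteMix p σ τ y) = m (σ x, σ y) (τ x, τ y))
    (ρ : Matrix (ι → Fin q) (ι → Fin q) ℂ) :
    sitePurity p ρ = swapPurity (prodMix m (siteMix fun z => p z.1))
      (ρ.submatrix (pairSplit hxy).symm (pairSplit hxy).symm) :=
  swapPurity_equiv (m' := prodMix m (siteMix fun z => p z.1)) (pairSplit hxy)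
    (fun σ τ => Prod.ext (hm σ τ) rfl) ρ

/-- The exchange acts on both sites of the gate or on neither, so it commutes with g ⊗ g. -/
lemma sitePurity_pairOp {x y : ι} (hxy : x ≠ y) {p : ι → Prop} (hp : p x ↔ p y)
    {g : Matrix (Fin q × Fin q) (Fin q × Fin q) ℂ} (hg : g ∈ Matrix.unitaryGroup _ ℂ)
    (ρ : Matrix (ι → Fin q) (ι → Fin q) ℂ) :
    sitePurity p (pairOp hxy g * ρ * (pairOp hxy g).conjTranspose) = sitePurity p ρ := by
  by_cases hx : p x
  · have hm : ∀ σ τ : ι → Fin q, (siteMix p σ τ x, siteMix p σ τ y)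
        = (fun c _ => c) (σ x, σ y) (τ x, τ y) := fun σ τ => by simp [siteMix, hx, hp.mp hx]
    rw [sitePurity_eq_prodMix hxy (fun c _ => c) hm, sitePurity_eq_prodMix hxy (fun c _ => c) hm, pairOp_conj,
      swapPurity_exchange_kronecker hg]
  · have hy : ¬ p y := fun h => hx (hp.mpr h)
    have hm : ∀ σ τ : ι → Fin q, (siteMix p σ τ x, siteMix p σ τ y)
        = (fun _ d => d) (σ x, σ y) (τ x, τ y) := fun σ τ => by simp [siteMix, hx, hy]
    rw [sitePurity_eq_prodMix hxy (fun _ d => d) hm, sitePurity_eq_prodMix hxy (fun _ d => d) hm, pairOp_conj,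
      swapPurity_keep_kronecker hg]

lemma integral_sitePurity_pairOp (hq : 1 ≤ q) {x y : ι} (hxy : x ≠ y) {p : ι → Prop}
    (hp : ¬ (p x ↔ p y)) (ρ : Matrix (ι → Fin q) (ι → Fin q) ℂ) :
    ∫ g : Gate q, sitePurity p (pairOp hxy g.1 * ρ * (pairOp hxy g.1).conjTranspose) ∂(haarGate q)
      = cutWeight q * (sitePurity (fun z => p z ∨ z = x ∨ z = y) ρ
        + sitePurity (fun z => p z ∧ ¬ (z = x ∨ z = y)) ρ) := by
  have h1 : sitePurity (fun z => p z ∨ z = x ∨ z = y) ρ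
      = swapPurity (prodMix (fun c _ => c) (siteMix fun z => p z.1))
      (ρ.submatrix (pairSplit hxy).symm (pairSplit hxy).symm) := by
    rw [sitePurity_eq_prodMix hxy (fun c _ => c) (by simp [siteMix])]
    congr 3
    funext z
    simp [z.2.1, z.2.2]
  have h2 : sitePurity (fun z => p z ∧ ¬ (z = x ∨ z = y)) ρ
      = swapPurity (prodMix (fun _ d => d) (siteMix fun z => p z.1))
      (ρ.submatrix (pairSplit hxy).symm (pairSplit hxy).symm) := by
    rw [sitePurity_eq_prodMix hxy (fun _ d => d) (by simp [siteMix])]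
    congr 3
    funext z
    simp [z.2.1, z.2.2]
  rw [h1, h2]
  by_cases hx : p x
  · have hy : ¬ p y := fun h => hp ⟨fun _ => h, fun _ => hx⟩
    have hm : ∀ σ τ : ι → Fin q, (siteMix p σ τ x, siteMix p σ τ y)
        = (fun c d => (c.1, d.2)) (σ x, σ y) (τ x, τ y) := fun σ τ => by simp [siteMix, hx, hy]
    simp only [sitePurity_eq_prodMix hxy (fun c d => (c.1, d.2)) hm, pairOp_conj]
    exact integral_swapPurity_kronecker (integral_replicaKernel_left hq) _ _
  · have hy : p y := by by_contra h; exact hp ⟨fun h' => (hx h').elim, fun h' => (h h').elim⟩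
    have hm : ∀ σ τ : ι → Fin q, (siteMix p σ τ x, siteMix p σ τ y)
        = (fun c d => (d.1, c.2)) (σ x, σ y) (τ x, τ y) := fun σ τ => by simp [siteMix, hx, hy]
    simp only [sitePurity_eq_prodMix hxy (fun c d => (d.1, c.2)) hm, pairOp_conj]
    exact integral_swapPurity_kronecker (integral_replicaKernel_right hq) _ _

end Sites

/-! ### Layers of gates -/

section Layers

open scoped Kronecker

variable {q : ℕ} {V : Type} [AddCommGroupWithOne V] [DecidableEq V]

/-- Even and odd sites alternate. -/
def AlternatingParity (V : Type) [AddCommGroupWithOne V] : Prop :=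
  ∀ x : V, Even (x + 1) ↔ ¬ Even x

/-- `N` is a union of pairs of layer `t`. -/
def IsPaired (t : ℕ) (N : Finset V) : Prop := ∀ x ∈ N, partner t x ∈ N

omit [DecidableEq V] in
lemma AlternatingParity.add_one_add (hV : AlternatingParity V) (x : V) (t : ℕ) :
    Even (x + 1 + (t : V)) ↔ ¬ Even (x + (t : V)) := by
  rw [add_right_comm]; exact hV _

omit [DecidableEq V] in
lemma AlternatingParity.sub_one_add (hV : AlternatingParity V) (x : V) (t : ℕ) :
    Even (x - 1 + (t : V)) ↔ ¬ Even (x + (t : V)) := by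
  have := hV.add_one_add (x - 1) t
  rw [sub_add_cancel] at this
  tauto

omit [DecidableEq V] in
lemma partner_of_even {t : ℕ} {x : V} (h : Even (x + (t : V))) : partner t x = x + 1 := if_pos h

omit [DecidableEq V] in
lemma partner_of_not_even {t : ℕ} {x : V} (h : ¬ Even (x + (t : V))) : partner t x = x - 1 :=
  if_neg h

omit [DecidableEq V] in
lemma AlternatingParity.partner_partner (hV : AlternatingParity V) (t : ℕ) (x : V) :
    partner t (partner t x) = x := by
  by_cases h : Even (x + (t : V))
  · rw [partner_of_even h, partner_of_not_even (by rw [hV.add_one_add]; simpa using h),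
      add_sub_cancel_right]
  · rw [partner_of_not_even h, partner_of_even (by rw [hV.sub_one_add]; exact h), sub_add_cancel]

lemma isPaired_hull (hV : AlternatingParity V) (t : ℕ) (Λ : Finset V) : IsPaired t (hull t Λ) := by
  intro x hx
  rcases Finset.mem_union.mp hx with h | h
  · exact Finset.mem_union_right _ (Finset.mem_image_of_mem _ h)
  · obtain ⟨y, hy, rfl⟩ := Finset.mem_image.mp h
    rw [hV.partner_partner]
    exact Finset.mem_union_left _ hy

lemma subset_hull (t : ℕ) (Λ : Finset V) : Λ ⊆ hull t Λ := Finset.subset_union_left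

omit [DecidableEq V] in
lemma IsPaired.add_one_mem {t : ℕ} {N : Finset V} (hN : IsPaired t N) {x : V} (hx : x ∈ N)
    (he : Even (x + (t : V))) : x + 1 ∈ N := partner_of_even he ▸ hN x hx

omit [DecidableEq V] in
lemma IsPaired.sub_one_mem {t : ℕ} {N : Finset V} (hN : IsPaired t N) {x : V} (hx : x ∈ N)
    (he : ¬ Even (x + (t : V))) : x - 1 ∈ N := partner_of_not_even he ▸ hN x hx

omit [DecidableEq V] in
lemma AlternatingParity.mk_ne (hV : AlternatingParity V) {N : Finset V} {x : V} (hx : x ∈ N)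
    (hx' : x + 1 ∈ N) : (⟨x, hx⟩ : N) ≠ ⟨x + 1, hx'⟩ := by
  intro h
  have h1 : x = x + 1 := congrArg Subtype.val h
  have := hV x
  rw [← h1] at this
  tauto

/-- The gate on a pair factors out of its layer. -/
lemma exists_layerMatrix_update (hq : 1 ≤ q) (hV : AlternatingParity V) (U : Circuit q V) {t : ℕ}
    {N : Finset V} {x : V} (hx : x ∈ N) (hx' : x + 1 ∈ N) (he : Even (x + (t : V))) :
    ∃ W : Matrix _ _ ℂ, ∀ u : Gate q, layerMatrix (Function.update U (t, x) u) t N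
      = (u.1 ⊗ₖ W).submatrix (pairSplit (hV.mk_ne hx hx')) (pairSplit (hV.mk_ne hx hx')) := by
  classical
  let e := pairSplit (q := q) (hV.mk_ne hx hx')
  -- An arbitrary filler: the remaining factors of the layer never read the sites x and x + 1.
  let p : Fin q × Fin q := (⟨0, hq⟩, ⟨0, hq⟩)
  have he' : ¬ Even (x + 1 + (t : V)) := by rw [hV.add_one_add]; simpa using he
  refine ⟨Matrix.of fun r s => ∏ z ∈ Finset.univ.erase (⟨x, hx⟩ : N),
    if h : Even (z.1 + (t : V)) ∧ z.1 + 1 ∈ N then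
      (U (t, z.1)).1 (e.symm (p, r) z, e.symm (p, r) ⟨z.1 + 1, h.2⟩)
        (e.symm (p, s) z, e.symm (p, s) ⟨z.1 + 1, h.2⟩)
    else 1, fun u => ?_⟩
  ext σ τ
  rw [layerMatrix, Matrix.of_apply, ← Finset.mul_prod_erase Finset.univ _ (Finset.mem_univ ⟨x, hx⟩)]
  rw [Matrix.submatrix_apply, Matrix.kroneckerMap_apply, Matrix.of_apply]
  congr 1
  · rw [dif_pos ⟨he, hx'⟩, Function.update_self]
    rfl
  · refine Finset.prod_congr rfl fun z hz => ?_
    have hzx : z.1 ≠ x := fun h => (Finset.mem_erase.mp hz).1 (Subtype.ext h)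
    by_cases h : Even (z.1 + (t : V)) ∧ z.1 + 1 ∈ N
    · rw [dif_pos h, dif_pos h, Function.update_of_ne (by simpa [Prod.ext_iff] using hzx)]
      have hz1 : ¬ Even (z.1 + 1 + (t : V)) := by rw [hV.add_one_add]; simpa using h.1
      have a1 : ∀ σ : N → Fin q, e.symm (p, (e σ).2) z = σ z := by
        intro σ
        have : z ≠ ⟨x, hx⟩ := fun h => hzx (congrArg Subtype.val h)
        have : z ≠ ⟨x + 1, hx'⟩ := fun h' => he' (by
          have := congrArg Subtype.val h'
          simp only at this
          rw [← this]; exact h.1)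
        simp [e, pairSplit, *]
      have a2 : ∀ σ : N → Fin q, e.symm (p, (e σ).2) ⟨z.1 + 1, h.2⟩ = σ ⟨z.1 + 1, h.2⟩ := by
        intro σ
        have : z.1 + 1 ≠ x := fun h' => hz1 (by rw [h']; exact he)
        have : z.1 + 1 ≠ x + 1 := fun h' => hzx (add_right_cancel h')
        simp [e, pairSplit, *]
      have b1 := a1 σ; have b2 := a2 σ; have b3 := a1 τ; have b4 := a2 τ
      simp only [e] at b1 b2 b3 b4
      simp only [e, b1, b2, b3, b4]
    · rw [dif_neg h, dif_neg h]

lemma layerMatrix_update_mul (hq : 1 ≤ q) (hV : AlternatingParity V) (U : Circuit q V) {t : ℕ}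
    {N : Finset V} {x : V} (hx : x ∈ N) (hx' : x + 1 ∈ N) (he : Even (x + (t : V)))
    (g u : Gate q) :
    layerMatrix (Function.update U (t, x) (g * u)) t N
      = pairOp (hV.mk_ne hx hx') g.1 * layerMatrix (Function.update U (t, x) u) t N := by
  obtain ⟨W, hW⟩ := exists_layerMatrix_update hq hV U hx hx' he
  rw [hW, hW, pairOp, Matrix.submatrix_mul_equiv, ← Matrix.mul_kronecker_mul, one_mul]
  rfl

lemma layerMatrix_eq_one {U : Circuit q V} {t : ℕ} {N : Finset V} (hV : AlternatingParity V)
    (hN : IsPaired t N) (hU : ∀ x ∈ N, Even (x + (t : V)) → U (t, x) = 1) :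
    layerMatrix U t N = 1 := by
  classical
  ext σ τ
  rw [layerMatrix, Matrix.of_apply, Matrix.one_apply]
  split_ifs with h
  · subst h
    refine Finset.prod_eq_one fun z _ => ?_
    split_ifs with hz
    · rw [hU z.1 z.2 hz.1]; simp
    · rfl
  · obtain ⟨z, hz⟩ := Function.ne_iff.mp h
    by_cases hp : Even (z.1 + (t : V))
    · refine Finset.prod_eq_zero (Finset.mem_univ z) ?_
      rw [dif_pos ⟨hp, hN.add_one_mem z.2 hp⟩, hU z.1 z.2 hp]
      simp [hz]
    · have hm := hN.sub_one_mem z.2 hp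
      have hp' : Even (z.1 - 1 + (t : V)) := by rw [hV.sub_one_add]; exact hp
      refine Finset.prod_eq_zero (Finset.mem_univ ⟨z.1 - 1, hm⟩) ?_
      rw [dif_pos ⟨hp', by simp⟩, hU _ hm hp']
      simp [hz]

/-- A layer is a product of gates on its pairs. -/
lemma layerMatrix_induction (hq : 1 ≤ q) (hV : AlternatingParity V) {t : ℕ} {N : Finset V}
    (hN : IsPaired t N) {F : LocalOp q N → Prop} (h1 : F 1)
    (hF : ∀ (x : V) (hx : x ∈ N) (hx' : x + 1 ∈ N), Even (x + (t : V)) → ∀ (g : Gate q) W,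
      F W → F (pairOp (hV.mk_ne hx hx') g.1 * W)) (U : Circuit q V) :
    F (layerMatrix U t N) := by
  -- Induction on a set S of positions outside which all gates are 1; each step splits off the gate
  -- at one position and resets it to 1.
  have key : ∀ (S : Finset V) (U : Circuit q V),
      (∀ x ∈ N, Even (x + (t : V)) → x ∉ S → U (t, x) = 1) → F (layerMatrix U t N) := by
    intro S
    induction S using Finset.induction_on with
    | empty =>
      intro U hU
      rw [layerMatrix_eq_one hV hN fun x hx he => hU x hx he (Finset.notMem_empty x)]
      exact h1
    | insert x S hxS ih =>
      intro U hU
      by_cases hx : x ∈ N ∧ Even (x + (t : V))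
      · have hx' := hN.add_one_mem hx.1 hx.2
        have h2 := layerMatrix_update_mul hq hV U hx.1 hx' hx.2 (U (t, x)) 1
        rw [mul_one, Function.update_eq_self] at h2
        rw [h2]
        refine hF x hx.1 hx' hx.2 _ _ (ih _ fun y hy hye hyS => ?_)
        by_cases hyx : y = x
        · subst hyx; exact Function.update_self _ _ _
        · rw [Function.update_of_ne (by simpa [Prod.ext_iff] using hyx)]
          exact hU y hy hye (by simp [hyx, hyS])
      · refine ih U fun y hy hye hyS => hU y hy hye ?_
        intro hm
        rcases Finset.mem_insert.mp hm with rfl | hm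
        · exact hx ⟨hy, hye⟩
        · exact hyS hm
  exact key N U fun x hx _ hxN => absurd hx hxN

lemma pairOp_conjTranspose_mul {ι : Type*} [Fintype ι] [DecidableEq ι] {x y : ι} (hxy : x ≠ y)
    (g : Gate q) : (pairOp hxy g.1).conjTranspose * pairOp hxy g.1 = 1 := by
  have hg := Matrix.mem_unitaryGroup_iff'.mp g.2
  rw [Matrix.star_eq_conjTranspose] at hg
  rw [pairOp, Matrix.conjTranspose_submatrix, Matrix.submatrix_mul_equiv,
    Matrix.conjTranspose_kronecker, ← Matrix.mul_kronecker_mul, hg]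
  simp

lemma layerMatrix_conjTranspose_mul (hq : 1 ≤ q) (hV : AlternatingParity V) {t : ℕ}
    {N : Finset V} (hN : IsPaired t N) (U : Circuit q V) :
    (layerMatrix U t N).conjTranspose * layerMatrix U t N = 1 := by
  refine layerMatrix_induction hq hV hN (F := fun W => W.conjTranspose * W = 1) (by simp) ?_ U
  intro x hx hx' _ g W hW
  rw [Matrix.conjTranspose_mul, Matrix.mul_assoc, ← Matrix.mul_assoc _ (pairOp _ _) W,
    pairOp_conjTranspose_mul, one_mul, hW]

lemma sitePurity_layerMatrix (hq : 1 ≤ q) (hV : AlternatingParity V) {t : ℕ}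
    {N : Finset V} (hN : IsPaired t N) (U : Circuit q V) {p : V → Prop}
    (hp : ∀ x, Even (x + (t : V)) → (p x ↔ p (x + 1))) (ρ : LocalOp q N) :
    sitePurity (fun z : N => p z.1)
        (layerMatrix U t N * ρ * (layerMatrix U t N).conjTranspose)
      = sitePurity (fun z : N => p z.1) ρ := by
  refine layerMatrix_induction hq hV hN (F := fun W =>
    sitePurity (fun z : N => p z.1) (W * ρ * W.conjTranspose)
      = sitePurity (fun z : N => p z.1) ρ) (by simp) ?_ U
  intro x hx hx' he g W hW
  rw [← hW, ← sitePurity_pairOp (hV.mk_ne hx hx') (p := fun z : N => p z.1) (hp x he) g.2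
    (W * ρ * W.conjTranspose)]
  simp only [Matrix.conjTranspose_mul, Matrix.mul_assoc]

end Layers

/-! ### Partial traces -/

section PartialTrace

variable {q : ℕ} {V : Type} [DecidableEq V]

/-- Configurations on `N` are pairs of configurations on `Λ` and on `N \ Λ`. -/
def glueEquiv {Λ N : Finset V} (h : Λ ⊆ N) :
    (Λ → Fin q) × (↥(N \ Λ) → Fin q) ≃ (N → Fin q) where
  toFun p := glue p.1 p.2
  invFun σ := (fun x => σ ⟨x.1, h x.2⟩, fun x => σ ⟨x.1, (Finset.mem_sdiff.mp x.2).1⟩)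
  left_inv p := by
    refine Prod.ext ?_ ?_
    · funext x
      simp [glue, x.2]
    · funext x
      simp [glue, (Finset.mem_sdiff.mp x.2).2]
  right_inv σ := by
    funext x
    by_cases hx : x.1 ∈ Λ <;> simp [glue, hx]

lemma sum_glue {Λ N : Finset V} (h : Λ ⊆ N) (f : (N → Fin q) → ℂ) :
    ∑ σ, f σ = ∑ s : Λ → Fin q, ∑ κ : ↥(N \ Λ) → Fin q, f (glue s κ) := by
  rw [← (glueEquiv h).sum_comp, Fintype.sum_prod_type]
  rfl

lemma trace_partialTrace {Λ N : Finset V} (h : Λ ⊆ N) (ρ : LocalOp q N) :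
    (partialTrace Λ ρ).trace = ρ.trace := by
  simp only [Matrix.trace, Matrix.diag, partialTrace, Matrix.of_apply]
  rw [sum_glue h]

lemma isHermitian_partialTrace {Λ N : Finset V} {ρ : LocalOp q N} (hρ : ρ.IsHermitian) :
    (partialTrace Λ ρ).IsHermitian := by
  ext σ τ
  simp only [partialTrace, Matrix.conjTranspose_apply, Matrix.of_apply, star_sum]
  exact Finset.sum_congr rfl fun κ _ => hρ.apply _ _

lemma siteMix_glue {Λ N : Finset V} {p : V → Prop} (hp : ∀ z ∈ N, p z → z ∈ Λ)
    (s s' : Λ → Fin q) (κ κ' : ↥(N \ Λ) → Fin q) :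
    siteMix (fun z : N => p z.1) (glue s κ) (glue s' κ')
      = glue (siteMix (fun z : Λ => p z.1) s s') κ' := by
  funext z
  by_cases hz : z.1 ∈ Λ
  · simp [siteMix, glue, hz]
  · have : ¬ p z.1 := fun h => hz (hp z.1 z.2 h)
    simp [siteMix, glue, hz, this]

/-- Outside the region each replica is contracted with itself, which is already the partial trace;
hence a region may be studied in any larger set of sites. -/
lemma sitePurity_partialTrace {Λ N : Finset V} (h : Λ ⊆ N) {p : V → Prop}
    (hp : ∀ z ∈ N, p z → z ∈ Λ) (ρ : LocalOp q N) :
    sitePurity (fun z : Λ => p z.1) (partialTrace Λ ρ) = sitePurity (fun z : N => p z.1) ρ := by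
  simp only [sitePurity, swapPurity, sum_glue h, siteMix_glue hp, partialTrace, Matrix.of_apply,
    Finset.sum_mul_sum]
  exact Finset.sum_congr rfl fun s _ => Finset.sum_comm

end PartialTrace

/-! ### States of the random circuit -/

section State

variable {q : ℕ} {V : Type} [AddCommGroupWithOne V] [DecidableEq V]

lemma layerMatrix_congr {U U' : Circuit q V} {t : ℕ} (h : ∀ x, U (t, x) = U' (t, x))
    (N : Finset V) : layerMatrix U t N = layerMatrix U' t N := by
  simp only [layerMatrix, h]

lemma circuitState_congr (φ : V → EuclideanSpace ℂ (Fin q)) {U U' : Circuit q V} {t : ℕ}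
    (h : ∀ s ≤ t, ∀ x, U (s, x) = U' (s, x)) (Λ : Finset V) :
    circuitState φ U t Λ = circuitState φ U' t Λ := by
  induction t generalizing Λ with
  | zero => rfl
  | succ t ih =>
    simp only [circuitState]
    rw [ih fun s hs => h s (hs.trans t.le_succ), layerMatrix_congr (h (t + 1) le_rfl)]

omit [AddCommGroupWithOne V] [DecidableEq V] in
lemma isHermitian_productState (φ : V → EuclideanSpace ℂ (Fin q)) (Λ : Finset V) :
    (productState φ Λ).IsHermitian := by
  ext σ τ
  simp only [productState, Matrix.conjTranspose_apply, Matrix.of_apply, star_prod, star_mul',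
    star_star]
  exact Finset.prod_congr rfl fun x _ => mul_comm _ _

lemma sum_prod_site {ι : Type*} [Fintype ι] [DecidableEq ι] (f : ι → Fin q → ℂ) :
    ∑ σ : ι → Fin q, ∏ x, f x (σ x) = ∏ x, ∑ k, f x k := by
  rw [Finset.prod_univ_sum, Fintype.piFinset_univ]

lemma sum_mul_star_of_norm {v : EuclideanSpace ℂ (Fin q)} (hv : ‖v‖ = 1) :
    ∑ k, v k * star (v k) = 1 := by
  have h := EuclideanSpace.norm_sq_eq v
  rw [hv] at h
  have h2 : ∀ k, v k * star (v k) = ((‖v k‖ ^ 2 : ℝ) : ℂ) := fun k => by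
    rw [Complex.star_def, Complex.mul_conj, Complex.normSq_eq_norm_sq]
  simp only [h2, ← Complex.ofReal_sum, ← h]
  simp

omit [AddCommGroupWithOne V] in
lemma trace_productState {φ : V → EuclideanSpace ℂ (Fin q)} (hφ : ∀ x, ‖φ x‖ = 1)
    (Λ : Finset V) : (productState φ Λ).trace = 1 := by
  simp only [Matrix.trace, Matrix.diag, productState, Matrix.of_apply]
  rw [sum_prod_site fun (x : Λ) k => φ x.1 k * star (φ x.1 k)]
  exact Finset.prod_eq_one fun x _ => sum_mul_star_of_norm (hφ x.1)

omit [AddCommGroupWithOne V] in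
-- At each site the two replicas carry the same pure state, so exchanging them changes nothing.
lemma sitePurity_productState {φ : V → EuclideanSpace ℂ (Fin q)} (hφ : ∀ x, ‖φ x‖ = 1)
    (Λ : Finset V) (p : Λ → Prop) : sitePurity p (productState φ Λ) = 1 := by
  have h1 : ∑ s : Λ → Fin q, ∏ x : Λ, φ x.1 (s x) * star (φ x.1 (s x)) = 1 := by
    rw [sum_prod_site fun (x : Λ) k => φ x.1 k * star (φ x.1 k)]
    exact Finset.prod_eq_one fun x _ => sum_mul_star_of_norm (hφ x.1)
  have h : ∀ s₁ s₂ : Λ → Fin q, productState φ Λ s₁ (siteMix p s₂ s₁)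
      * productState φ Λ s₂ (siteMix p s₁ s₂)
      = (∏ x : Λ, φ x.1 (s₁ x) * star (φ x.1 (s₁ x)))
        * ∏ x : Λ, φ x.1 (s₂ x) * star (φ x.1 (s₂ x)) := by
    intro s₁ s₂
    simp only [productState, Matrix.of_apply, ← Finset.prod_mul_distrib]
    refine Finset.prod_congr rfl fun x _ => ?_
    by_cases hx : p x
    · rw [show siteMix p s₂ s₁ x = s₂ x from if_pos hx, show siteMix p s₁ s₂ x = s₁ x from if_pos hx,
        mul_mul_mul_comm, mul_comm (star _), ← mul_mul_mul_comm]
    · rw [show siteMix p s₂ s₁ x = s₁ x from if_neg hx, show siteMix p s₁ s₂ x = s₂ x from if_neg hx]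
  simp only [sitePurity, swapPurity, h, ← Finset.mul_sum, ← Finset.sum_mul]
  rw [h1, mul_one]

lemma isHermitian_circuitState (φ : V → EuclideanSpace ℂ (Fin q)) (U : Circuit q V) (t : ℕ)
    (Λ : Finset V) : (circuitState φ U t Λ).IsHermitian := by
  induction t generalizing Λ with
  | zero => exact isHermitian_productState φ Λ
  | succ t ih =>
    exact isHermitian_partialTrace (Matrix.isHermitian_mul_mul_conjTranspose _ (ih _))

lemma trace_circuitState (hq : 1 ≤ q) (hV : AlternatingParity V)
    {φ : V → EuclideanSpace ℂ (Fin q)} (hφ : ∀ x, ‖φ x‖ = 1) (U : Circuit q V) (t : ℕ)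
    (Λ : Finset V) : (circuitState φ U t Λ).trace = 1 := by
  induction t generalizing Λ with
  | zero => exact trace_productState hφ Λ
  | succ t ih =>
    simp only [circuitState]
    rw [trace_partialTrace (subset_hull _ _), Matrix.trace_mul_cycle,
      layerMatrix_conjTranspose_mul hq hV (isPaired_hull hV _ _), one_mul, ih]

lemma continuous_layerMatrix (t : ℕ) (N : Finset V) :
    Continuous fun U : Circuit q V => layerMatrix U t N := by
  refine continuous_matrix fun σ τ => ?_
  simp only [layerMatrix, Matrix.of_apply]
  refine continuous_finsetProd _ fun z _ => ?_
  split_ifs with h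
  · exact (continuous_gate_apply _ _).comp (continuous_apply _)
  · exact continuous_const

lemma continuous_circuitState (φ : V → EuclideanSpace ℂ (Fin q)) (t : ℕ) (Λ : Finset V) :
    Continuous fun U : Circuit q V => circuitState φ U t Λ := by
  induction t generalizing Λ with
  | zero => exact continuous_const
  | succ t ih =>
    have h := ((continuous_layerMatrix (q := q) (t + 1) (hull (t + 1) Λ)).matrix_mul
      (ih (hull (t + 1) Λ))).matrix_mul
      (continuous_layerMatrix (q := q) (t + 1) (hull (t + 1) Λ)).matrix_conjTranspose
    refine continuous_matrix fun σ τ => ?_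
    simp only [circuitState, partialTrace, Matrix.of_apply]
    exact continuous_finsetSum _ fun κ _ => h.matrix_elem _ _

lemma continuous_sitePurity {ι : Type*} [Fintype ι] [DecidableEq ι] (p : ι → Prop) :
    Continuous fun ρ : Matrix (ι → Fin q) (ι → Fin q) ℂ => sitePurity p ρ := by
  refine continuous_finsetSum _ fun s₁ _ => continuous_finsetSum _ fun s₂ _ => ?_
  exact (continuous_id.matrix_elem _ _).mul (continuous_id.matrix_elem _ _)

lemma continuous_pairOp {ι : Type*} [Fintype ι] [DecidableEq ι] {x y : ι} (hxy : x ≠ y) :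
    Continuous fun g : Gate q => pairOp hxy g.1 := by
  refine continuous_matrix fun σ τ => ?_
  simp only [pairOp, Matrix.submatrix_apply, Matrix.kroneckerMap_apply]
  exact (continuous_gate_apply _ _).mul continuous_const

/-- The state on `N` after layer `t`, from that on `N` before layer `t`. -/
def evolvedState (φ : V → EuclideanSpace ℂ (Fin q)) (t : ℕ) (N : Finset V) (U : Circuit q V) :
    LocalOp q N :=
  layerMatrix U (t + 1) N * circuitState φ U t N * (layerMatrix U (t + 1) N).conjTranspose

lemma continuous_evolvedState (φ : V → EuclideanSpace ℂ (Fin q)) (t : ℕ) (N : Finset V) :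
    Continuous (evolvedState φ t N) :=
  ((continuous_layerMatrix _ _).matrix_mul (continuous_circuitState _ _ _)).matrix_mul
    (continuous_layerMatrix _ _).matrix_conjTranspose

lemma evolvedState_update (hq : 1 ≤ q) (hV : AlternatingParity V)
    (φ : V → EuclideanSpace ℂ (Fin q)) {t : ℕ} {N : Finset V} (U : Circuit q V) {x : V}
    (hx : x ∈ N) (hx' : x + 1 ∈ N) (he : Even (x + ((t + 1 : ℕ) : V))) (g : Gate q) :
    evolvedState φ t N (Function.update U (t + 1, x) (g * U (t + 1, x)))
      = pairOp (hV.mk_ne hx hx') g.1 * evolvedState φ t N U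
        * (pairOp (hV.mk_ne hx hx') g.1).conjTranspose := by
  -- The earlier layers do not contain the modified gate.
  have h1 : circuitState φ (Function.update U (t + 1, x) (g * U (t + 1, x))) t N
      = circuitState φ U t N := by
    refine circuitState_congr φ (fun s hs y => Function.update_of_ne ?_ _ _) N
    simp only [ne_eq, Prod.mk.injEq, not_and]
    omega
  rw [evolvedState, h1, layerMatrix_update_mul hq hV U hx hx' he, Function.update_eq_self,
    evolvedState, Matrix.conjTranspose_mul]
  simp only [Matrix.mul_assoc]

omit [AddCommGroupWithOne V] in
lemma map_update_mul_circuitMeasure (i : ℕ × V) (g : Gate q) :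
    (circuitMeasure q V).map (fun U => Function.update U i (g * U i)) = circuitMeasure q V := by
  have h := Measure.infinitePi_map_pi (fun _ : ℕ × V => haarGate q)
    (f := fun j u => if j = i then g * u else u) (fun j => by
      split_ifs
      · exact measurable_const_mul g
      · exact measurable_id)
  have h2 : ∀ j : ℕ × V, (haarGate q).map (fun u => if j = i then g * u else u) = haarGate q := by
    intro j
    by_cases hj : j = i
    · simp only [hj, if_true]; exact map_mul_left_eq_self _ g
    · simp only [hj, if_false]; exact Measure.map_id'
  simp only [h2] at h
  rw [circuitMeasure]
  convert h using 2
  funext U j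
  by_cases hj : j = i
  · subst hj; simp
  · simp [hj]

omit [AddCommGroupWithOne V] in
lemma measurable_update_mul (i : ℕ × V) (g : Gate q) :
    Measurable fun U : Circuit q V => Function.update U i (g * U i) := by
  refine measurable_pi_lambda _ fun j => ?_
  by_cases hj : j = i
  · subst hj
    simp only [Function.update_self]
    exact (measurable_const_mul g).comp (measurable_pi_apply j)
  · simpa [hj] using measurable_pi_apply j

omit [AddCommGroupWithOne V] in
instance instIsProbabilityMeasureCircuitMeasure : IsProbabilityMeasure (circuitMeasure q V) := by
  unfold circuitMeasure; infer_instance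

variable [Countable V]

/-- Averaging over a gate across the boundary of the region `p`. -/
lemma integral_sitePurity_evolvedState (hq : 1 ≤ q) (hV : AlternatingParity V)
    (φ : V → EuclideanSpace ℂ (Fin q)) {t : ℕ} {N : Finset V} {x : V}
    (hx : x ∈ N) (hx' : x + 1 ∈ N) (he : Even (x + ((t + 1 : ℕ) : V))) {p : V → Prop}
    (hp : ¬ (p x ↔ p (x + 1))) :
    ∫ U, sitePurity (fun z : N => p z.1) (evolvedState φ t N U) ∂(circuitMeasure q V)
      = cutWeight q *
        (∫ U, sitePurity (fun z : N => p z.1 ∨ z.1 = x ∨ z.1 = x + 1) (evolvedState φ t N U)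
            ∂(circuitMeasure q V)
          + ∫ U, sitePurity (fun z : N => p z.1 ∧ ¬ (z.1 = x ∨ z.1 = x + 1))
            (evolvedState φ t N U) ∂(circuitMeasure q V)) := by
  have hc : ∀ p : N → Prop, Continuous fun U => sitePurity p (evolvedState φ t N U) :=
    fun p => (continuous_sitePurity p).comp (continuous_evolvedState φ t N)
  let G : Gate q → Circuit q V → ℂ := fun g U => sitePurity (fun z : N => p z.1)
    (pairOp (hV.mk_ne hx hx') g.1 * evolvedState φ t N U
      * (pairOp (hV.mk_ne hx hx') g.1).conjTranspose)
  have hG : Continuous (Function.uncurry G) := by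
    refine (continuous_sitePurity _).comp ?_
    have h1 := (continuous_pairOp (q := q) (hV.mk_ne hx hx')).comp
      (continuous_fst (Y := Circuit q V))
    exact (h1.matrix_mul ((continuous_evolvedState φ t N).comp continuous_snd)).matrix_mul
      h1.matrix_conjTranspose
  -- Multiplying the gate at (t + 1, x) by g preserves the measure, so the integral is the same for
  -- every g. It may therefore be averaged over an extra Haar gate, which Fubini moves inside.
  have h1 : ∀ g : Gate q, ∫ U, sitePurity (fun z : N => p z.1) (evolvedState φ t N U)
      ∂(circuitMeasure q V) = ∫ U, G g U ∂(circuitMeasure q V) := by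
    intro g
    conv_lhs => rw [← map_update_mul_circuitMeasure (t + 1, x) g]
    rw [integral_map (measurable_update_mul _ g).aemeasurable (hc _).aestronglyMeasurable]
    simp only [evolvedState_update hq hV φ _ hx hx' he g, G]
  have h2 : ∫ U, sitePurity (fun z : N => p z.1) (evolvedState φ t N U) ∂(circuitMeasure q V)
      = ∫ g, ∫ U, G g U ∂(circuitMeasure q V) ∂(haarGate q) := by
    simp only [← h1]
    simp
  rw [h2, integral_integral_swap (integrable_of_continuous hG)]
  have h3 : ∀ U, ∫ g, G g U ∂(haarGate q) = cutWeight q *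
      (sitePurity (fun z : N => p z.1 ∨ z.1 = x ∨ z.1 = x + 1) (evolvedState φ t N U)
        + sitePurity (fun z : N => p z.1 ∧ ¬ (z.1 = x ∨ z.1 = x + 1)) (evolvedState φ t N U)) := by
    intro U
    have := integral_sitePurity_pairOp hq (hV.mk_ne hx hx') (p := fun z : N => p z.1) hp
      (evolvedState φ t N U)
    simpa only [Subtype.ext_iff] using this
  simp only [h3]
  rw [integral_const_mul, integral_add (integrable_of_continuous (hc _))
    (integrable_of_continuous (hc _))]

end State

/-! ### The averaged purity of an interval -/

section Interval

variable {q : ℕ} {V : Type} [AddCommGroupWithOne V] [DecidableEq V]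

lemma mem_interval {a z : V} {n : ℕ} : z ∈ interval a n ↔ ∃ i < n, a + ((i : ℕ) : V) = z := by
  simp only [interval, Finset.mem_image, Finset.mem_univ, true_and]
  exact ⟨fun ⟨i, hi⟩ => ⟨i, i.2, hi⟩, fun ⟨i, hi, h⟩ => ⟨⟨i, hi⟩, h⟩⟩

/-- The sites `0, …, n - 1` are distinct. -/
def CastInjBelow (V : Type) [AddCommGroupWithOne V] (n : ℕ) : Prop :=
  ∀ i < n, ∀ j < n, (i : V) = j → i = j

omit [DecidableEq V] in
lemma CastInjBelow.mono {m n : ℕ} (h : CastInjBelow V n) (hm : m ≤ n) : CastInjBelow V m :=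
  fun i hi j hj => h i (hi.trans_le hm) j (hj.trans_le hm)

lemma interval_union_left (a : V) (n : ℕ) (z : V) :
    (z ∈ interval a (n + 1) ∨ z = a - 1 ∨ z = a - 1 + 1) ↔ z ∈ interval (a - 1) (n + 2) := by
  simp only [mem_interval]
  constructor
  · rintro (⟨i, hi, rfl⟩ | rfl | rfl)
    · exact ⟨i + 1, by omega, by push_cast; abel⟩
    · exact ⟨0, by omega, by simp⟩
    · exact ⟨1, by omega, by simp⟩
  · rintro ⟨i, hi, rfl⟩
    rcases i with _ | i
    · right; left; simp
    · exact Or.inl ⟨i, by omega, by push_cast; abel⟩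

lemma sub_one_notMem_interval {n : ℕ} (h : CastInjBelow V (n + 1)) (a : V) :
    a - 1 ∉ interval a n := by
  rw [mem_interval]
  rintro ⟨i, hi, he⟩
  have : ((i + 1 : ℕ) : V) = (0 : ℕ) := by
    push_cast
    rw [sub_eq_add_neg] at he
    rw [add_left_cancel he]
    simp
  have := h _ (by omega) _ (by omega) this
  omega

/-- Unlike adding a pair, removing one needs distinct sites: on too short a circle a - 1 would
itself be a site of the interval. -/
lemma interval_sdiff_left {n : ℕ} (h : CastInjBelow V (n + 2)) (a z : V) :
    (z ∈ interval a (n + 1) ∧ ¬ (z = a - 1 ∨ z = a - 1 + 1)) ↔ z ∈ interval (a + 1) n := by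
  have h0 := sub_one_notMem_interval h a
  constructor
  · rintro ⟨hz, hn⟩
    obtain ⟨i, hi, rfl⟩ := mem_interval.mp hz
    rcases i with _ | i
    · exact absurd (Or.inr (by simp)) hn
    · exact mem_interval.mpr ⟨i, by omega, by push_cast; abel⟩
  · intro hz
    obtain ⟨i, hi, rfl⟩ := mem_interval.mp hz
    have hm : a + 1 + (i : V) ∈ interval a (n + 1) :=
      mem_interval.mpr ⟨i + 1, by omega, by push_cast; abel⟩
    refine ⟨hm, ?_⟩
    rintro (he | he)
    · rw [he] at hm; exact h0 hm
    · have : ((i + 1 : ℕ) : V) = (0 : ℕ) := by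
        rw [sub_add_cancel, add_assoc, add_eq_left] at he
        push_cast
        rw [add_comm]; exact he
      have := h _ (by omega) _ (by omega) this
      omega

lemma interval_union_right (a : V) (n : ℕ) (z : V) :
    (z ∈ interval a (n + 1) ∨ z = a + (n : V) ∨ z = a + (n : V) + 1)
      ↔ z ∈ interval a (n + 2) := by
  simp only [mem_interval]
  constructor
  · rintro (⟨i, hi, rfl⟩ | rfl | rfl)
    · exact ⟨i, by omega, rfl⟩
    · exact ⟨n, by omega, rfl⟩
    · exact ⟨n + 1, by omega, by push_cast; abel⟩
  · rintro ⟨i, hi, rfl⟩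
    rcases Nat.lt_or_ge i (n + 1) with h | h
    · exact Or.inl ⟨i, h, rfl⟩
    · obtain rfl : i = n + 1 := by omega
      right; right; push_cast; abel

lemma add_natCast_notMem_interval {m n : ℕ} (hm : n ≤ m) (h : CastInjBelow V (m + 1)) (a : V) :
    a + (m : V) ∉ interval a n := by
  rw [mem_interval]
  rintro ⟨i, hi, he⟩
  have := h i (by omega) m (by omega) (add_left_cancel he)
  omega

lemma interval_sdiff_right {n : ℕ} (h : CastInjBelow V (n + 2)) (a z : V) :
    (z ∈ interval a (n + 1) ∧ ¬ (z = a + (n : V) ∨ z = a + (n : V) + 1)) ↔ z ∈ interval a n := by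
  constructor
  · rintro ⟨hz, hn⟩
    obtain ⟨i, hi, rfl⟩ := mem_interval.mp hz
    refine mem_interval.mpr ⟨i, ?_, rfl⟩
    rcases Nat.lt_or_ge i n with h' | h'
    · exact h'
    · obtain rfl : i = n := by omega
      exact absurd (Or.inl rfl) hn
  · intro hz
    refine ⟨?_, ?_⟩
    · obtain ⟨i, hi, rfl⟩ := mem_interval.mp hz
      exact mem_interval.mpr ⟨i, by omega, rfl⟩
    · rintro (rfl | rfl)
      · exact add_natCast_notMem_interval le_rfl (h.mono (by omega)) a hz
      · refine add_natCast_notMem_interval (n := n) (m := n + 1) (by omega) h a ?_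
        push_cast
        rwa [← add_assoc]

omit [DecidableEq V] in
lemma AlternatingParity.even_natCast (hV : AlternatingParity V) (n : ℕ) :
    Even (n : V) ↔ Even n := by
  induction n with
  | zero => simp
  | succ n ih => rw [Nat.cast_succ, hV, ih, Nat.even_add_one]

omit [DecidableEq V] in
lemma even_add_iff_of_even {x y : V} (hy : Even y) : Even (x + y) ↔ Even x :=
  ⟨fun h => by simpa using h.sub hy, fun h => h.add hy⟩

/-- An even interval starting at the left site of a pair is a union of pairs, so no gate of that
layer crosses its boundary. -/
lemma mem_interval_add_one_iff (hV : AlternatingParity V) {b x : V} {t : ℕ} (k : ℕ)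
    (hb : Even (b + (t : V))) (hx : Even (x + (t : V))) :
    x ∈ interval b (2 * k) ↔ x + 1 ∈ interval b (2 * k) := by
  have hi : ∀ i : ℕ, b + (i : V) = x → Even i := by
    rintro i rfl
    rw [← hV.even_natCast]
    have : b + (i : V) + t = i + (b + t) := by abel
    rwa [this, even_add_iff_of_even hb] at hx
  simp only [mem_interval]
  constructor
  · rintro ⟨i, hik, rfl⟩
    obtain ⟨j, rfl⟩ := hi i rfl
    exact ⟨j + j + 1, by omega, by push_cast; abel⟩
  · rintro ⟨i, hik, he⟩
    rcases i with _ | i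
    · exfalso
      have : x + 1 = b := by simpa using he.symm
      rw [← this, hV.add_one_add] at hb
      exact hb hx
    · refine ⟨i, by omega, ?_⟩
      push_cast at he
      rw [← add_assoc] at he
      exact add_right_cancel he

/-! ### The recursion for the averaged purity -/

/-- The averaged purity of an interval of length `2 d` after `t` layers. -/
def purityRec (q : ℕ) : ℕ → ℕ → ℝ
  | 0, _ => 1
  | _ + 1, 0 => 1
  | t + 1, d + 1 =>
    cutWeight q ^ 2 * (purityRec q t (d + 2) + 2 * purityRec q t (d + 1) + purityRec q t d)

lemma purityRec_zero_right (q t : ℕ) : purityRec q t 0 = 1 := by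
  cases t <;> rfl

variable [Countable V]

/-- The state is taken on a larger set M because all intervals produced by one layer must be regions
of a common set for the induction. The hypothesis `ha` says that layer t cuts the left end, hence
also the right end as the length is even; no cut is needed when the interval is empty or t = 0. -/
lemma integral_sitePurity_interval (hq : 1 ≤ q) (hV : AlternatingParity V)
    {φ : V → EuclideanSpace ℂ (Fin q)} (hφ : ∀ x, ‖φ x‖ = 1) (t d : ℕ) (a : V) (M : Finset V)
    (hM : interval a (2 * d) ⊆ M) (hinj : CastInjBelow V (2 * d + 2 * t))
    (ha : 0 < d → 0 < t → ¬ Even (a + (t : V))) :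
    ∫ U, sitePurity (fun z : M => z.1 ∈ interval a (2 * d)) (circuitState φ U t M)
      ∂(circuitMeasure q V) = purityRec q t d := by
  induction t generalizing d a M with
  | zero =>
    simp [circuitState, sitePurity_productState hφ, purityRec]
  | succ t ih =>
    have hP := isPaired_hull hV (t + 1) M
    have hs := subset_hull (t + 1) M
    set N := hull (t + 1) M with hN
    have h1 : ∀ U, sitePurity (fun z : M => z.1 ∈ interval a (2 * d)) (circuitState φ U (t + 1) M)
        = sitePurity (fun z : N => z.1 ∈ interval a (2 * d)) (evolvedState φ t N U) := fun U =>
      sitePurity_partialTrace hs (fun z _ hz => hM hz) _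
    simp only [h1]
    -- An interval aligned with layer t + 1 does not feel that layer; the parity shift then makes
    -- layer t cut its ends, as the induction hypothesis asks.
    have hclosed : ∀ b k, (0 < k → Even (b + ((t + 1 : ℕ) : V))) → interval b (2 * k) ⊆ N →
        CastInjBelow V (2 * k + 2 * t) →
        ∫ U, sitePurity (fun z : N => z.1 ∈ interval b (2 * k)) (evolvedState φ t N U)
          ∂(circuitMeasure q V) = purityRec q t k := by
      intro b k hb hbN hk
      rw [← ih k b N hbN hk]
      · refine integral_congr_ae (.of_forall fun U => ?_)
        refine sitePurity_layerMatrix hq hV hP U (p := fun z => z ∈ interval b (2 * k)) ?_ _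
        intro x hx
        rcases Nat.eq_zero_or_pos k with rfl | hk0
        · simp [mem_interval]
        · exact mem_interval_add_one_iff hV k (hb hk0) hx
      · intro hk0 _
        have := hb hk0
        rwa [Nat.cast_succ, ← add_assoc, hV] at this
    rcases d with _ | d
    · have := hclosed a 0 (by simp) (by simp [interval]) (hinj.mono (by omega))
      rw [purityRec_zero_right] at this ⊢
      exact this
    · have ha' := ha (by omega) (by omega)
      have el : Even (a - 1 + ((t + 1 : ℕ) : V)) := by rw [hV.sub_one_add]; exact ha'
      have er : Even (a + 1 + ((t + 1 : ℕ) : V)) := by rw [hV.add_one_add]; exact ha'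
      have hxr : a - 1 + ((2 * d + 2 : ℕ) : V) = a + 1 + ((2 * d : ℕ) : V) := by
        push_cast
        have : (2 : V) = 1 + 1 := one_add_one_eq_two.symm
        rw [this]; abel
      have ex : Even (a - 1 + ((2 * d + 2 : ℕ) : V) + ((t + 1 : ℕ) : V)) := by
        rw [add_right_comm, even_add_iff_of_even ((hV.even_natCast _).mpr ⟨d + 1, by omega⟩)]
        exact el
      have hmem : ∀ i < 2 * d + 2, a + (i : V) ∈ N := fun i hi =>
        hs (hM (mem_interval.mpr ⟨i, by omega, rfl⟩))
      have m1 : a - 1 + 1 ∈ N := by simpa using hmem 0 (by omega)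
      have m0 : a - 1 ∈ N := by
        refine hP.sub_one_mem (by simpa using m1) ha'
      have m2 : a - 1 + ((2 * d + 2 : ℕ) : V) ∈ N := by
        have := hmem (2 * d + 1) (by omega)
        rw [hxr]
        convert this using 1
        push_cast; abel
      have m3 : a - 1 + ((2 * d + 2 : ℕ) : V) + 1 ∈ N := hP.add_one_mem m2 ex
      have hsub : ∀ z, z ∈ interval (a - 1) (2 * d + 4) → z ∈ N := by
        intro z hz
        rcases (interval_union_right (a - 1) (2 * d + 2) z).mpr hz with h | rfl | rfl
        · rcases (interval_union_left a (2 * d + 1) z).mpr h with h | rfl | rfl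
          · exact hs (hM h)
          · exact m0
          · exact m1
        · exact m2
        · exact m3
      have i1 := hclosed (a - 1) (d + 2) (fun _ => el) hsub (hinj.mono (by omega))
      have i2 := hclosed (a - 1) (d + 1) (fun _ => el) (fun z hz => hsub z (by
        obtain ⟨i, hi, rfl⟩ := mem_interval.mp hz
        exact mem_interval.mpr ⟨i, by omega, rfl⟩)) (hinj.mono (by omega))
      have i3 := hclosed (a + 1) (d + 1) (fun _ => er) (fun z hz => hsub z (by
        obtain ⟨i, hi, rfl⟩ := mem_interval.mp hz
        refine mem_interval.mpr ⟨i + 2, by omega, ?_⟩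
        have : (2 : V) = 1 + 1 := one_add_one_eq_two.symm
        push_cast; rw [this]; abel)) (hinj.mono (by omega))
      have i4 := hclosed (a + 1) d (fun _ => er) (fun z hz => hsub z (by
        obtain ⟨i, hi, rfl⟩ := mem_interval.mp hz
        refine mem_interval.mpr ⟨i + 2, by omega, ?_⟩
        have : (2 : V) = 1 + 1 := one_add_one_eq_two.symm
        push_cast; rw [this]; abel)) (hinj.mono (by omega))
      -- The gate at the left end is averaged first, giving intervals of odd length 2d + 3 and 2d +
      -- 1. The gate at the common right end, averaged in each, makes the lengths even again.
      have s1 := integral_sitePurity_evolvedState hq hV φ m0 m1 el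
        (p := fun z => z ∈ interval a (2 * (d + 1))) (fun h =>
          sub_one_notMem_interval (hinj.mono (by omega)) a
            (h.mpr (mem_interval.mpr ⟨0, by omega, by simp⟩)))
      have s2 := integral_sitePurity_evolvedState hq hV φ m2 m3 ex
        (p := fun z => z ∈ interval (a - 1) (2 * d + 3)) (fun h => by
          refine add_natCast_notMem_interval (m := 2 * d + 2 + 1) le_rfl
            (hinj.mono (by omega)) (a - 1) ?_
          rw [Nat.cast_succ, ← add_assoc]
          exact h.mp (mem_interval.mpr ⟨2 * d + 2, by omega, rfl⟩))
      rw [hxr] at m2 m3 ex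
      have s3 := integral_sitePurity_evolvedState hq hV φ m2 m3 ex
        (p := fun z => z ∈ interval (a + 1) (2 * d + 1)) (fun h => by
          refine add_natCast_notMem_interval (m := 2 * d + 1) le_rfl
            (hinj.mono (by omega)) (a + 1) ?_
          rw [Nat.cast_succ, ← add_assoc]
          exact h.mp (mem_interval.mpr ⟨2 * d, by omega, rfl⟩))
      let I : V → ℕ → ℂ := fun b n =>
        ∫ U, sitePurity (fun z : N => z.1 ∈ interval b n) (evolvedState φ t N U)
          ∂(circuitMeasure q V)
      have t1 : I a (2 * d + 2) = cutWeight q * (I (a - 1) (2 * d + 3) + I (a + 1) (2 * d + 1)) := by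
        simpa only [interval_union_left a (2 * d + 1), interval_sdiff_left (n := 2 * d + 1)
          (hinj.mono (by omega)) a, show 2 * (d + 1) = 2 * d + 1 + 1 from rfl] using s1
      have t2 : I (a - 1) (2 * d + 3)
          = cutWeight q * (I (a - 1) (2 * d + 4) + I (a - 1) (2 * d + 2)) := by
        simpa only [interval_union_right (a - 1) (2 * d + 2), interval_sdiff_right
          (n := 2 * d + 2) (hinj.mono (by omega)) (a - 1)] using s2
      have t3 : I (a + 1) (2 * d + 1)
          = cutWeight q * (I (a + 1) (2 * d + 2) + I (a + 1) (2 * d)) := by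
        simpa only [interval_union_right (a + 1) (2 * d), interval_sdiff_right
          (n := 2 * d) (hinj.mono (by omega)) (a + 1)] using s3
      have j1 : I (a - 1) (2 * d + 4) = purityRec q t (d + 2) := i1
      have j2 : I (a - 1) (2 * d + 2) = purityRec q t (d + 1) := i2
      have j3 : I (a + 1) (2 * d + 2) = purityRec q t (d + 1) := i3
      have j4 : I (a + 1) (2 * d) = purityRec q t d := i4
      change I a (2 * d + 2) = _
      rw [t1, t2, t3, j1, j2, j3, j4, purityRec]
      push_cast
      ring

end Interval

/-! ### Bounds on the averaged purity -/

section Bounds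

variable {q : ℕ}

/-- The bracket is q^{-2d}(1 + q^{-2})², and K(1 + q^{-2}) = q^{-1}. These values are the purities
of maximally mixed intervals. -/
lemma cutWeight_stationary (hq : 1 ≤ q) (d : ℕ) :
    cutWeight q ^ 2 * (((q : ℝ) ^ 2)⁻¹ ^ (d + 2) + 2 * ((q : ℝ) ^ 2)⁻¹ ^ (d + 1)
      + ((q : ℝ) ^ 2)⁻¹ ^ d) = ((q : ℝ) ^ 2)⁻¹ ^ (d + 1) := by
  have hq0 : (q : ℝ) ≠ 0 := by positivity
  have h : cutWeight q ^ 2 * (((q : ℝ) ^ 2)⁻¹ ^ 2 + 2 * ((q : ℝ) ^ 2)⁻¹ + 1) = ((q : ℝ) ^ 2)⁻¹ := by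
    unfold cutWeight
    field_simp
    ring
  calc _ = ((q : ℝ) ^ 2)⁻¹ ^ d * (cutWeight q ^ 2 * (((q : ℝ) ^ 2)⁻¹ ^ 2
        + 2 * ((q : ℝ) ^ 2)⁻¹ + 1)) := by ring
    _ = _ := by rw [h]; ring

lemma inv_sq_mem_Icc (hq : 1 ≤ q) : 0 ≤ ((q : ℝ) ^ 2)⁻¹ ∧ ((q : ℝ) ^ 2)⁻¹ ≤ 1 := by
  have : (1 : ℝ) ≤ q := by exact_mod_cast hq
  exact ⟨by positivity, inv_le_one_of_one_le₀ (one_le_pow₀ this)⟩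

/-- The excess obeys the same recursion with nonnegative weights of total 4K², starts in [0,1] and
vanishes at d = 0. -/
lemma purityRec_sub_bounds (hq : 1 ≤ q) (t d : ℕ) :
    0 ≤ purityRec q t d - ((q : ℝ) ^ 2)⁻¹ ^ d ∧
      purityRec q t d - ((q : ℝ) ^ 2)⁻¹ ^ d ≤ (4 * cutWeight q ^ 2) ^ t := by
  obtain ⟨h0, h1⟩ := inv_sq_mem_Icc hq
  induction t generalizing d with
  | zero =>
    have h2 := pow_le_one₀ (n := d) h0 h1
    have h3 := pow_nonneg h0 d
    simp only [purityRec, pow_zero]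
    constructor <;> linarith
  | succ t ih =>
    rcases d with _ | d
    · simp only [purityRec, pow_zero, sub_self, le_refl, true_and]
      positivity
    · obtain ⟨a1, b1⟩ := ih (d + 2)
      obtain ⟨a2, b2⟩ := ih (d + 1)
      obtain ⟨a3, b3⟩ := ih d
      have hK : 0 ≤ cutWeight q ^ 2 := sq_nonneg _
      rw [← cutWeight_stationary hq d, purityRec, ← mul_sub, pow_succ]
      refine ⟨mul_nonneg hK (by linarith), ?_⟩
      calc _ ≤ cutWeight q ^ 2 * (4 * (4 * cutWeight q ^ 2) ^ t) :=
            mul_le_mul_of_nonneg_left (by linarith) hK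
        _ = _ := by ring

/-! ### The lower bound by a reflected random walk -/

/-- The cumulative distribution of the displacement of `2 t` steps of a simple random walk, in
units of two steps and up to normalization. -/
def walkCDF : ℕ → ℤ → ℝ
  | 0, m => if 0 ≤ m then 1 else 0
  | t + 1, m => walkCDF t (m - 1) + 2 * walkCDF t m + walkCDF t (m + 1)

lemma walkCDF_mono (t : ℕ) : Monotone (walkCDF t) := by
  induction t with
  | zero =>
    intro a b hab
    simp only [walkCDF]
    split_ifs
    · exact le_rfl
    · omega
    · norm_num
    · exact le_rfl
  | succ t ih =>
    intro a b hab
    have h1 := ih (show a - 1 ≤ b - 1 by omega)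
    have h2 := ih hab
    have h3 := ih (show a + 1 ≤ b + 1 by omega)
    simp only [walkCDF]
    linarith

lemma walkCDF_eq_zero (t : ℕ) (m : ℤ) (h : m < -t) : walkCDF t m = 0 := by
  induction t generalizing m with
  | zero => simp only [walkCDF]; rw [if_neg (by simpa using h)]
  | succ t ih =>
    push_cast at h
    rw [walkCDF, ih _ (by omega), ih _ (by omega), ih _ (by omega)]; ring

/-- The jumps of the distribution count walks of 2t steps by their number k of steps to the right.
-/
lemma walkCDF_sub (t k : ℕ) :
    walkCDF t ((k : ℤ) - t) - walkCDF t ((k : ℤ) - t - 1) = (2 * t).choose k := by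
  induction t generalizing k with
  | zero =>
    rcases k with _ | k
    · simp [walkCDF]
    · simp [walkCDF]
      rw [if_pos (by omega)]; norm_num
  | succ t ih =>
    -- Pascal's rule applied twice involves the entries k, k - 1 and k - 2; for k = 0 and k = 1 the
    -- missing entries are zeros of `walkCDF` left of -t.
    rcases k with _ | _ | k
    · have h0 := ih 0
      simp only [walkCDF]
      push_cast at h0 ⊢
      rw [walkCDF_eq_zero t (0 - (t + 1) - 1) (by omega), walkCDF_eq_zero t (0 - (t + 1)) (by omega),
        walkCDF_eq_zero t (0 - (t + 1) - 1 - 1) (by omega),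
        show (0 : ℤ) - (t + 1) + 1 = 0 - t by ring, show (0 : ℤ) - (t + 1) - 1 + 1 = 0 - t - 1 by ring]
      simp at h0 ⊢
      linarith
    · have h0 := ih 0
      have h1 := ih 1
      have z1 : walkCDF t (-t - 1) = 0 := walkCDF_eq_zero t _ (by omega)
      have z2 : walkCDF t (-t - 2) = 0 := walkCDF_eq_zero t _ (by omega)
      simp only [walkCDF]
      rw [show ((0 : ℕ) : ℤ) - t - 1 = -t - 1 by push_cast; ring,
        show ((0 : ℕ) : ℤ) - t = -t by push_cast; ring, z1] at h0
      rw [show ((1 : ℕ) : ℤ) - t - 1 = -t by push_cast; ring] at h1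
      rw [show ((0 + 1 : ℕ) : ℤ) - (t + 1 : ℕ) - 1 - 1 = -t - 2 by push_cast; ring,
        show ((0 + 1 : ℕ) : ℤ) - (t + 1 : ℕ) - 1 + 1 = -t by push_cast; ring,
        show ((0 + 1 : ℕ) : ℤ) - (t + 1 : ℕ) - 1 = -t - 1 by push_cast; ring,
        show ((0 + 1 : ℕ) : ℤ) - (t + 1 : ℕ) + 1 = (1 : ℕ) - t by push_cast; ring,
        show ((0 + 1 : ℕ) : ℤ) - (t + 1 : ℕ) = -t by push_cast; ring, z1, z2]
      simp only [Nat.choose_zero_right, zero_add, Nat.choose_one_right] at h0 h1 ⊢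
      push_cast at h0 h1 ⊢
      linarith
    · have hc : ((2 * (t + 1)).choose (k + 1 + 1) : ℝ)
          = (2 * t).choose k + 2 * (2 * t).choose (k + 1) + (2 * t).choose (k + 2) := by
        rw [show 2 * (t + 1) = 2 * t + 1 + 1 by ring, Nat.choose_succ_succ' (2 * t + 1) (k + 1),
          Nat.choose_succ_succ' (2 * t) k, Nat.choose_succ_succ' (2 * t) (k + 1)]
        push_cast; ring
      rw [hc, ← ih k, ← ih (k + 1), ← ih (k + 2)]
      simp only [walkCDF]
      push_cast
      ring_nf

/-- Reflection: W_t(d) - W_t(-d) is odd in d, so it satisfies the recursion of the excess, up to the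
factor K² per layer, with the same zero at d = 0. Initially it is 1 for d ≥ 1, where the excess 1 -
q^{-2d} is at least 1 - q^{-2}. -/
lemma purityRec_sub_lower (hq : 1 ≤ q) (t d : ℕ) :
    (1 - ((q : ℝ) ^ 2)⁻¹) * (cutWeight q ^ 2) ^ t * (walkCDF t d - walkCDF t (-d))
      ≤ purityRec q t d - ((q : ℝ) ^ 2)⁻¹ ^ d := by
  obtain ⟨h0, h1⟩ := inv_sq_mem_Icc hq
  induction t generalizing d with
  | zero =>
    rcases d with _ | d
    · simp [purityRec]
    · have : ((q : ℝ) ^ 2)⁻¹ ^ (d + 1) ≤ ((q : ℝ) ^ 2)⁻¹ := pow_le_of_le_one h0 h1 (by omega)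
      simp only [walkCDF, purityRec, pow_zero]
      rw [if_pos (by positivity), if_neg (by push_cast; omega)]
      linarith
  | succ t ih =>
    rcases d with _ | d
    · simp [purityRec]
    · have a1 := ih (d + 2)
      have a2 := ih (d + 1)
      have a3 := ih d
      rw [← cutWeight_stationary hq d, purityRec, ← mul_sub]
      simp only [walkCDF]
      push_cast at a1 a2 a3 ⊢
      rw [show (d : ℤ) + 1 - 1 = d by ring, show (d : ℤ) + 1 + 1 = d + 2 by ring,
        show -((d : ℤ) + 1) - 1 = -(d + 2) by ring, show -((d : ℤ) + 1) + 1 = -d by ring]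
      calc _ = cutWeight q ^ 2 * (
            (1 - ((q : ℝ) ^ 2)⁻¹) * (cutWeight q ^ 2) ^ t * (walkCDF t (d + 2) - walkCDF t (-(d + 2)))
            + 2 * ((1 - ((q : ℝ) ^ 2)⁻¹) * (cutWeight q ^ 2) ^ t
              * (walkCDF t (d + 1) - walkCDF t (-(d + 1))))
            + (1 - ((q : ℝ) ^ 2)⁻¹) * (cutWeight q ^ 2) ^ t * (walkCDF t d - walkCDF t (-d))) := by
            ring
        _ ≤ _ := mul_le_mul_of_nonneg_left (by linarith) (sq_nonneg _)

/-- By monotonicity W_t(d) - W_t(-d) ≥ W_t(0) - W_t(-1), which is the central binomial coefficient.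
The factor 1/(t+1) is simply given away. -/
lemma purityRec_sub_ge_catalan (hq : 1 ≤ q) (t d : ℕ) (hd : 1 ≤ d) :
    (1 - ((q : ℝ) ^ 2)⁻¹) / (t + 1) * ((2 * t).choose t : ℝ) * ((q : ℝ) / ((q : ℝ) ^ 2 + 1)) ^ (2 * t)
      ≤ purityRec q t d - ((q : ℝ) ^ 2)⁻¹ ^ d := by
  obtain ⟨h0, h1⟩ := inv_sq_mem_Icc hq
  refine le_trans ?_ (purityRec_sub_lower hq t d)
  have h2 : ((2 * t).choose t : ℝ) ≤ walkCDF t d - walkCDF t (-d) := by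
    rw [← walkCDF_sub t t]
    have e1 := walkCDF_mono t (show (t : ℤ) - t ≤ d by omega)
    have e2 := walkCDF_mono t (show (-d : ℤ) ≤ (t : ℤ) - t - 1 by omega)
    linarith
  have h3 : (1 - ((q : ℝ) ^ 2)⁻¹) / (t + 1) ≤ 1 - ((q : ℝ) ^ 2)⁻¹ :=
    div_le_self (by linarith) (by linarith [(Nat.cast_nonneg t : (0 : ℝ) ≤ t)])
  have hK : 0 ≤ (cutWeight q ^ 2) ^ t := by positivity
  calc _ = (1 - ((q : ℝ) ^ 2)⁻¹) / (t + 1) * (cutWeight q ^ 2) ^ t * ((2 * t).choose t : ℝ) := by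
        rw [pow_mul, cutWeight]; ring
    _ ≤ _ := by
        refine mul_le_mul (mul_le_mul_of_nonneg_right h3 hK) h2 (by positivity) ?_
        exact mul_nonneg (by linarith) hK

/-! ### Thermalization times -/

/-- The exponential decay rate of the purity excess, per half layer. -/
def decayRate (q : ℕ) : ℝ := Real.log (((q : ℝ) ^ 2 + 1) / (2 * q))

lemma log_sub_log_two_lt_decayRate (hq : 1 ≤ q) :
    Real.log q - Real.log 2 < decayRate q := by
  have hq0 : (0 : ℝ) < q := by positivity
  rw [decayRate, ← Real.log_div (by positivity) (by norm_num)]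
  refine Real.log_lt_log (by positivity) ?_
  rw [div_lt_div_iff₀ (by norm_num) (by positivity)]
  nlinarith

/-- Since 4K² = exp(-2 · `decayRate`), the hypothesis is half the logarithm of q^{2d}(4K²)^T < ε².
-/
lemma pow_mul_purityRec_sub_one_lt (hq : 1 ≤ q) {T d : ℕ} {ε : ℝ} (hε : 0 < ε)
    (h : (d : ℝ) * Real.log q + Real.log (1 / ε) < T * decayRate q) :
    (q : ℝ) ^ (2 * d) * purityRec q T d - 1 < ε ^ 2 := by
  have hq0 : (0 : ℝ) < q := by positivity
  have h1 := (purityRec_sub_bounds hq T d).2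
  have h2 : (q : ℝ) ^ (2 * d) * ((q : ℝ) ^ 2)⁻¹ ^ d = 1 := by
    rw [pow_mul, ← mul_pow, mul_inv_cancel₀ (by positivity), one_pow]
  have h3 : (q : ℝ) ^ (2 * d) * (4 * cutWeight q ^ 2) ^ T < ε ^ 2 := by
    have hK : 0 < cutWeight q := by unfold cutWeight; positivity
    rw [← Real.log_lt_log_iff (by positivity) (by positivity), Real.log_mul (by positivity)
      (by positivity), Real.log_pow, Real.log_pow, Real.log_pow]
    have h4 : Real.log (4 * cutWeight q ^ 2) = - 2 * decayRate q := by
      rw [decayRate, show 4 * cutWeight q ^ 2 = ((((q : ℝ) ^ 2 + 1) / (2 * q))⁻¹) ^ 2 by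
        unfold cutWeight; field_simp; ring, Real.log_pow, Real.log_inv]
      push_cast; ring
    rw [h4]
    rw [one_div, Real.log_inv] at h
    push_cast
    linarith
  calc _ = (q : ℝ) ^ (2 * d) * (purityRec q T d - ((q : ℝ) ^ 2)⁻¹ ^ d) := by rw [mul_sub, h2]
    _ ≤ (q : ℝ) ^ (2 * d) * (4 * cutWeight q ^ 2) ^ T :=
      mul_le_mul_of_nonneg_left h1 (by positivity)
    _ < _ := h3

lemma three_mul_log_two_le (hq : 3 ≤ q) : 3 * Real.log 2 ≤ 2 * Real.log q := by
  have h1 : 3 * Real.log 2 = Real.log (2 ^ 3) := by rw [Real.log_pow]; norm_num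
  have h2 : 2 * Real.log q = Real.log ((q : ℝ) ^ 2) := by rw [Real.log_pow]; norm_num
  rw [h1, h2]
  have : (3 : ℝ) ≤ q := by exact_mod_cast hq
  exact Real.log_le_log (by norm_num) (by nlinarith)

/-- For q = 2 the general bound log q - log 2 is zero, so log(5/4) is estimated directly. The ratio
9/28 is what `thermal_time_two` requires, and (5/4)^28 barely exceeds 2^9. -/
lemma decayRate_two_bounds :
    9 * Real.log 2 ≤ 28 * decayRate 2 ∧ 3 * decayRate 2 ≤ Real.log 2 := by
  have h : decayRate 2 = Real.log (5 / 4) := by unfold decayRate; norm_num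
  rw [h]
  have e1 : 9 * Real.log 2 = Real.log (2 ^ 9) := by rw [Real.log_pow]; norm_num
  have e2 : 28 * Real.log (5 / 4) = Real.log ((5 / 4) ^ 28) := by rw [Real.log_pow]; norm_num
  have e3 : 3 * Real.log (5 / 4) = Real.log ((5 / 4) ^ 3) := by rw [Real.log_pow]; norm_num
  rw [e1, e2, e3]
  exact ⟨Real.log_le_log (by norm_num) (by norm_num), Real.log_le_log (by norm_num) (by norm_num)⟩

lemma neg_log_two_le_log_one_div {ε : ℝ} (hε : 0 < ε) (hε2 : ε ≤ 2) :
    -Real.log 2 ≤ Real.log (1 / ε) := by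
  rw [one_div, Real.log_inv]
  exact neg_le_neg (Real.log_le_log hε hε2)

lemma thermal_time_of_three_le (hq : 3 ≤ q) {d : ℕ} (hd : 1 ≤ d) {b T : ℝ} (hb : -Real.log 2 ≤ b)
    (hT0 : 0 ≤ T)
    (hT : d * (1 + 3 * (Real.log 2 / Real.log q)) + 3 * b / Real.log q < T) :
    d * Real.log q + b < T * decayRate q := by
  have hl2 : 0 < Real.log 2 := Real.log_pos (by norm_num)
  have hq1 : (3 : ℝ) ≤ q := by exact_mod_cast hq
  have hlq : 0 < Real.log q := Real.log_pos (by linarith)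
  have hx := three_mul_log_two_le hq
  have hd1 : (1 : ℝ) ≤ d := by exact_mod_cast hd
  have h1 : T * (Real.log q - Real.log 2) ≤ T * decayRate q :=
    mul_le_mul_of_nonneg_left (log_sub_log_two_lt_decayRate (by omega)).le hT0
  refine lt_of_lt_of_le ?_ h1
  have h2 : 0 < Real.log q - Real.log 2 := by linarith
  refine lt_of_le_of_lt ?_ (mul_lt_mul_of_pos_right hT h2)
  -- This is exactly the slack of the inequality. Its first factor is nonnegative because q² ≥ 8,
  -- its second because d ≥ 1 and b ≥ -log 2.
  have h3 : 0 ≤ (2 * Real.log q - 3 * Real.log 2) * (d * Real.log 2 + b) / Real.log q := by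
    refine div_nonneg (mul_nonneg (by linarith) ?_) hlq.le
    nlinarith
  refine sub_nonneg.mp (h3.trans_eq ?_)
  field_simp
  ring

/-- With r = `decayRate 2`, one has 3r ≤ log 2, so large b hurts. The cutoff b ≤ 8d log 2, which is
ε ≥ 2^{-4ℓ}, leaves the slack (28r - 9 log 2)d. -/
lemma thermal_time_two {d : ℕ} (hd : 1 ≤ d) {b T : ℝ}
    (hb' : b ≤ 8 * d * Real.log 2)
    (hT : d * (1 + 3 * (Real.log 2 / Real.log 2)) + 3 * b / Real.log 2 < T) :
    d * Real.log 2 + b < T * decayRate 2 := by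
  have hl2 : 0 < Real.log 2 := Real.log_pos (by norm_num)
  obtain ⟨h1, h2⟩ := decayRate_two_bounds
  have hd1 : (1 : ℝ) ≤ d := by exact_mod_cast hd
  refine lt_of_le_of_lt ?_ (mul_lt_mul_of_pos_right hT (by linarith))
  have h3 : 0 ≤ ((4 * decayRate 2 - Real.log 2) * (d * Real.log 2)
      - (Real.log 2 - 3 * decayRate 2) * b) / Real.log 2 := by
    refine div_nonneg ?_ hl2.le
    have := mul_le_mul_of_nonneg_left hb' (show 0 ≤ Real.log 2 - 3 * decayRate 2 by linarith)
    have h4 : 0 ≤ (28 * decayRate 2 - 9 * Real.log 2) * (d * Real.log 2) :=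
      mul_nonneg (by linarith) (by positivity)
    linarith
  refine sub_nonneg.mp (h3.trans_eq ?_)
  field_simp
  ring

/-- The coefficient 4 of b makes the slack factor as (4r - log 2)(d log 2 + b)/log 2 with r =
`decayRate 2`, so no lower cutoff on ε is needed. -/
lemma thermal_time_two' {d : ℕ} (hd : 1 ≤ d) {b T : ℝ} (hb : -Real.log 2 ≤ b)
    (hT : d * (1 + 3 * (Real.log 2 / Real.log 2)) + 4 * b / Real.log 2 < T) :
    d * Real.log 2 + b < T * decayRate 2 := by
  have hl2 : 0 < Real.log 2 := Real.log_pos (by norm_num)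
  obtain ⟨h1, h2⟩ := decayRate_two_bounds
  have hd1 : (1 : ℝ) ≤ d := by exact_mod_cast hd
  refine lt_of_le_of_lt ?_ (mul_lt_mul_of_pos_right hT (by linarith))
  have h3 : 0 ≤ (4 * decayRate 2 - Real.log 2) * (d * Real.log 2 + b) / Real.log 2 := by
    refine div_nonneg (mul_nonneg (by linarith) ?_) hl2.le
    nlinarith
  refine sub_nonneg.mp (h3.trans_eq ?_)
  field_simp
  ring

/-- The case b = d log 2, that is ε = 2^{-ℓ/2}. The strict bound on `decayRate` allows equality in
the time. -/
lemma thermal_time_half (hq : 3 ≤ q) {d : ℕ} (hd : 1 ≤ d) {T : ℝ}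
    (hT : d * (1 + 6 * (Real.log 2 / Real.log q)) ≤ T) :
    d * Real.log q + d * Real.log 2 < T * decayRate q := by
  have hl2 : 0 < Real.log 2 := Real.log_pos (by norm_num)
  have hq1 : (3 : ℝ) ≤ q := by exact_mod_cast hq
  have hlq : 0 < Real.log q := Real.log_pos (by linarith)
  have hx := three_mul_log_two_le hq
  have hd1 : (1 : ℝ) ≤ d := by exact_mod_cast hd
  have hT0 : 0 < T := lt_of_lt_of_le (by positivity) hT
  have h1 : T * (Real.log q - Real.log 2) < T * decayRate q :=
    mul_lt_mul_of_pos_left (log_sub_log_two_lt_decayRate (by omega)) hT0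
  refine lt_of_le_of_lt ?_ h1
  have h2 : 0 < Real.log q - Real.log 2 := by linarith
  refine le_trans ?_ (mul_le_mul_of_nonneg_right hT h2.le)
  have h3 : 0 ≤ (2 * Real.log q - 3 * Real.log 2) * (2 * d * Real.log 2) / Real.log q := by
    refine div_nonneg (mul_nonneg (by linarith) (by positivity)) hlq.le
  refine sub_nonneg.mp (h3.trans_eq ?_)
  field_simp
  ring

end Bounds

/-! ### Trace norm and Hilbert–Schmidt norm -/

open scoped ComplexOrder in
lemma eigenvalues_conjTranspose_mul_self_nonneg {n : Type} [Fintype n] [DecidableEq n]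
    (A : Matrix n n ℂ) (i : n) :
    0 ≤ (Matrix.isHermitian_conjTranspose_mul_self A).eigenvalues i :=
  (Matrix.posSemidef_conjTranspose_mul_self A).eigenvalues_nonneg i

section Norms

variable {n : Type} [Fintype n]

lemma trace_pow_eq_sum_eigenvalues [DecidableEq n] {B : Matrix n n ℂ} (hB : B.IsHermitian)
    (k : ℕ) : (B ^ k).trace = ∑ i, ((hB.eigenvalues i : ℝ) : ℂ) ^ k := by
  conv_lhs => rw [hB.spectral_theorem]
  rw [← map_pow, Unitary.conjStarAlgAut_apply, Matrix.trace_mul_cycle, Unitary.coe_star_mul_self,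
    one_mul, Matrix.diagonal_pow, Matrix.trace_diagonal]
  rfl

lemma hsNorm_sq (A : Matrix n n ℂ) : hsNorm A ^ 2 = (A.conjTranspose * A).trace.re := by
  classical
  refine Real.sq_sqrt ?_
  have hH := Matrix.isHermitian_conjTranspose_mul_self A
  rw [hH.trace_eq_sum_eigenvalues]
  have h : ∀ i, 0 ≤ hH.eigenvalues i :=
    eigenvalues_conjTranspose_mul_self_nonneg A
  simpa using Finset.sum_nonneg fun i _ => h i

/-- Cauchy–Schwarz for the list of singular values. -/
lemma traceNorm_sq_le [DecidableEq n] (A : Matrix n n ℂ) :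
    traceNorm A ^ 2 ≤ Fintype.card n * hsNorm A ^ 2 := by
  have hH := Matrix.isHermitian_conjTranspose_mul_self A
  have h : ∀ i, 0 ≤ hH.eigenvalues i :=
    eigenvalues_conjTranspose_mul_self_nonneg A
  have h1 : hsNorm A ^ 2 = ∑ i, √(hH.eigenvalues i) ^ 2 := by
    rw [hsNorm_sq, hH.trace_eq_sum_eigenvalues]
    simp [Real.sq_sqrt (h _)]
  rw [h1]
  exact sq_sum_le_card_mul_sum_sq

/-- Eigenvalues are awkward as functions of the matrix, but sums of polynomials in them are traces
of powers, hence continuous. Polynomials within 1/(m+1) of the square root on [0, m] converge at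
every eigenvalue, so the trace norm is a pointwise limit of continuous functions. -/
lemma measurable_traceNorm [DecidableEq n] {X : Type*} [TopologicalSpace X] [MeasurableSpace X]
    [OpensMeasurableSpace X] {f : X → Matrix n n ℂ} (hf : Continuous f) :
    Measurable fun x => traceNorm (f x) := by
  have happ : ∀ m : ℕ, ∃ p : Polynomial ℝ, ∀ y ∈ Set.Icc (0 : ℝ) m,
      |p.eval y - √y| < 1 / ((m : ℝ) + 1) := fun m =>
    exists_polynomial_near_of_continuousOn 0 m Real.sqrt Real.continuous_sqrt.continuousOn _
      (by positivity)
  choose p hp using happ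
  have hH := fun x => Matrix.isHermitian_conjTranspose_mul_self (f x)
  have hcont : ∀ m, Continuous fun x => ∑ i, (p m).eval ((hH x).eigenvalues i) := by
    intro m
    have : ∀ x, ∑ i, (p m).eval ((hH x).eigenvalues i)
        = ∑ k ∈ Finset.range ((p m).natDegree + 1),
          (p m).coeff k * (((f x).conjTranspose * f x) ^ k).trace.re := by
      intro x
      simp only [Polynomial.eval_eq_sum_range]
      rw [Finset.sum_comm]
      refine Finset.sum_congr rfl fun k _ => ?_
      rw [← Finset.mul_sum, trace_pow_eq_sum_eigenvalues (hH x), ← Complex.ofReal_re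
        (∑ i, (hH x).eigenvalues i ^ k)]
      push_cast
      rfl
    simp only [this]
    refine continuous_finsetSum _ fun k _ => continuous_const.mul ?_
    exact Complex.continuous_re.comp
      ((hf.matrix_conjTranspose.matrix_mul hf).pow k).matrix_trace
  refine measurable_of_tendsto_metrizable (fun m => (hcont m).measurable) ?_
  rw [tendsto_pi_nhds]
  intro x
  refine tendsto_finsetSum _ fun i _ => ?_
  have h0 : 0 ≤ (hH x).eigenvalues i :=
    eigenvalues_conjTranspose_mul_self_nonneg (f x) i
  obtain ⟨m₀, hm₀⟩ := exists_nat_ge ((hH x).eigenvalues i)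
  rw [tendsto_iff_norm_sub_tendsto_zero]
  refine squeeze_zero' (.of_forall fun _ => norm_nonneg _) ?_ tendsto_one_div_add_atTop_nhds_zero_nat
  filter_upwards [Filter.eventually_ge_atTop m₀] with m hm
  exact (hp m _ ⟨h0, hm₀.trans (by exact_mod_cast hm)⟩).le

lemma continuous_hsNorm_sq {X : Type*} [TopologicalSpace X] {f : X → Matrix n n ℂ}
    (hf : Continuous f) : Continuous fun x => hsNorm (f x) ^ 2 := by
  simp only [hsNorm_sq]
  exact Complex.continuous_re.comp (hf.matrix_conjTranspose.matrix_mul hf).matrix_trace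

lemma integrable_traceNorm_sq [DecidableEq n] {X : Type*} [TopologicalSpace X] [CompactSpace X]
    [MeasurableSpace X] [OpensMeasurableSpace X] {μ : Measure X} [IsFiniteMeasure μ]
    {f : X → Matrix n n ℂ} (hf : Continuous f) : Integrable (fun x => traceNorm (f x) ^ 2) μ := by
  refine ((integrable_of_continuous (continuous_hsNorm_sq hf)).const_mul
    (Fintype.card n : ℝ)).mono' ((measurable_traceNorm hf).pow_const 2).aestronglyMeasurable
    (.of_forall fun x => ?_)
  rw [Real.norm_of_nonneg (by positivity)]
  exact traceNorm_sq_le _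

lemma purity_submatrix {m : Type} [Fintype m] (e : m ≃ n) (ρ : Matrix n n ℂ) :
    purity (ρ.submatrix e e) = purity ρ := by
  simp only [purity, Matrix.submatrix_mul_equiv, Matrix.trace, Matrix.diag, Matrix.submatrix_apply]
  rw [e.sum_comp fun i => (ρ * ρ) i i]

end Norms

lemma rpow_half_eq_sqrt (q ℓ : ℕ) : (q : ℝ) ^ ((ℓ : ℝ) / 2) = √((q : ℝ) ^ ℓ) := by
  rw [Real.sqrt_eq_rpow, ← Real.rpow_natCast, ← Real.rpow_mul (by positivity)]
  ring_nf

lemma card_config (q ℓ : ℕ) : (Fintype.card (Fin ℓ → Fin q) : ℝ) = (q : ℝ) ^ ℓ := by simp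

lemma traceNorm_le_rpow_mul_hsNorm {q ℓ : ℕ} (A : Matrix (Fin ℓ → Fin q) (Fin ℓ → Fin q) ℂ) :
    traceNorm A ≤ (q : ℝ) ^ ((ℓ : ℝ) / 2) * hsNorm A := by
  rw [rpow_half_eq_sqrt]
  have h0 : 0 ≤ hsNorm A := Real.sqrt_nonneg _
  refine abs_le_of_sq_le_sq' ?_ (by positivity) |>.2
  rw [mul_pow, Real.sq_sqrt (by positivity), ← card_config]
  exact traceNorm_sq_le A

lemma hsNorm_sub_maxMixed_sq {q ℓ : ℕ} (hq : 1 ≤ q)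
    {ρ : Matrix (Fin ℓ → Fin q) (Fin ℓ → Fin q) ℂ} (hρ : ρ.IsHermitian) (ht : ρ.trace = 1) :
    hsNorm (ρ - maxMixed q ℓ) ^ 2 = purity ρ - ((q : ℝ) ^ ℓ)⁻¹ := by
  have hq0 : ((q : ℂ) ^ ℓ) ≠ 0 := pow_ne_zero _ (by exact_mod_cast (by omega : q ≠ 0))
  have hm : (maxMixed q ℓ).conjTranspose = maxMixed q ℓ := by
    simp [maxMixed, Matrix.conjTranspose_smul]
  have h1 : ((ρ - maxMixed q ℓ).conjTranspose * (ρ - maxMixed q ℓ)).trace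
      = (ρ * ρ).trace - ((q : ℂ) ^ ℓ)⁻¹ := by
    rw [Matrix.conjTranspose_sub, hρ.eq, hm]
    simp only [maxMixed, sub_mul, mul_sub, Matrix.trace_sub, Matrix.mul_smul, Matrix.smul_mul,
      Matrix.mul_one, Matrix.one_mul, Matrix.trace_smul, ht, Matrix.trace_one]
    simp
    field_simp
    ring
  rw [hsNorm_sq, h1, purity, Complex.sub_re]
  congr 1
  rw [← Complex.ofReal_re (((q : ℝ) ^ ℓ)⁻¹)]
  push_cast
  rfl

/-! ### States close to the maximally mixed state have complexity zero -/

open scoped ComplexOrder in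
lemma preparable_maxMixed {q : ℕ} (hq : 1 ≤ q) (ℓ : ℕ) : Preparable q 0 ℓ (maxMixed q ℓ) := by
  have h : maxMixed q ℓ = tensor fun _ : Fin ℓ => ((q : ℂ)⁻¹ • (1 : Matrix (Fin q) (Fin q) ℂ)) := by
    ext σ τ
    simp only [maxMixed, tensor, Matrix.smul_apply, Matrix.of_apply, Matrix.one_apply, smul_eq_mul]
    rw [Finset.prod_mul_distrib]
    simp only [Finset.prod_const, Finset.card_univ, Fintype.card_fin, inv_pow]
    congr 1
    rw [Fintype.prod_ite_zero]
    simp [funext_iff]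
  rw [h]
  refine Preparable.product _ fun _ => ⟨Matrix.PosSemidef.one.smul ?_, ?_⟩
  · simp
  · have : (q : ℂ) ≠ 0 := by exact_mod_cast (by omega : q ≠ 0)
    simp [Matrix.trace_smul, this]

lemma complexity_eq_zero {q ℓ : ℕ} (hq : 1 ≤ q) {δ : ℝ}
    {σ : Matrix (Fin ℓ → Fin q) (Fin ℓ → Fin q) ℂ}
    (h : traceNorm (σ - maxMixed q ℓ) / 2 ≤ δ) : complexity δ σ = 0 := by
  refine le_antisymm ?_ zero_le
  exact (iInf₂_le (f := fun (N : ℕ) (_ : N ∈ {N : ℕ | ∃ ρ, Preparable q N ℓ ρ ∧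
    traceNorm (σ - ρ) / 2 ≤ δ}) => (N : ℕ∞)) 0 ⟨_, preparable_maxMixed hq ℓ, h⟩).trans (by simp)

/-- Nonzero complexity forces the trace norm above 2δ, because the maximally mixed state costs
nothing; Markov's inequality for its square does the rest. -/
lemma measureReal_complexity_ne_zero_le {q ℓ : ℕ} (hq : 1 ≤ q) {X : Type*} [MeasurableSpace X]
    {μ : Measure X} [IsFiniteMeasure μ] {f : X → Matrix (Fin ℓ → Fin q) (Fin ℓ → Fin q) ℂ}
    (hf : Integrable (fun x => traceNorm (f x - maxMixed q ℓ) ^ 2) μ) {ε δ : ℝ} (hδ : 0 < δ)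
    (hε : ∫ x, traceNorm (f x - maxMixed q ℓ) ^ 2 ∂μ ≤ ε ^ 2) :
    μ.real {x | complexity δ (f x) ≠ 0} ≤ (ε / (2 * δ)) ^ 2 := by
  have h1 := mul_meas_ge_le_integral_of_nonneg (μ := μ)
    (.of_forall fun x => sq_nonneg (traceNorm (f x - maxMixed q ℓ))) hf ((2 * δ) ^ 2)
  have h2 : μ.real {x | complexity δ (f x) ≠ 0}
      ≤ μ.real {x | (2 * δ) ^ 2 ≤ traceNorm (f x - maxMixed q ℓ) ^ 2} := by
    refine measureReal_mono fun x hx => ?_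
    by_contra hn
    refine hx (complexity_eq_zero hq ?_)
    have := lt_of_pow_lt_pow_left₀ 2 (by positivity : 0 ≤ 2 * δ) (not_le.mp hn)
    linarith
  rw [div_pow, le_div_iff₀ (by positivity), mul_comm]
  exact (mul_le_mul_of_nonneg_left h2 (by positivity)).trans (h1.trans hε)

/-! ### The interval state -/

section IntervalState

variable {q : ℕ} {V : Type} [AddCommGroupWithOne V] [DecidableEq V]

lemma add_intervalLabel (a : V) (ℓ : ℕ) (x : interval a ℓ) :
    a + ((intervalLabel a ℓ x : ℕ) : V) = x.1 :=
  (Finset.mem_image.mp x.2).choose_spec.2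

/-- Relabels the sites of an interval of distinct sites. -/
def labelEquiv (a : V) {ℓ : ℕ} (h : CastInjBelow V ℓ) :
    (Fin ℓ → Fin q) ≃ (interval a ℓ → Fin q) :=
  Equiv.arrowCongr (Equiv.ofBijective (intervalLabel a ℓ) (by
    constructor
    · intro x y hxy
      rw [Subtype.ext_iff, ← add_intervalLabel a ℓ x, ← add_intervalLabel a ℓ y, hxy]
    · intro i
      have hi : a + ((i : ℕ) : V) ∈ interval a ℓ := mem_interval.mpr ⟨i, i.2, rfl⟩
      refine ⟨⟨_, hi⟩, Fin.ext (h _ (Fin.is_lt _) _ i.2 ?_)⟩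
      exact add_left_cancel (add_intervalLabel a ℓ ⟨_, hi⟩))).symm (Equiv.refl _)

lemma intervalState_eq_submatrix (φ : V → EuclideanSpace ℂ (Fin q)) (U : Circuit q V) (T : ℕ)
    (a : V) {ℓ : ℕ} (h : CastInjBelow V ℓ) :
    intervalState φ U T a ℓ
      = (circuitState φ U T (interval a ℓ)).submatrix (labelEquiv a h) (labelEquiv a h) := rfl

lemma isHermitian_intervalState (φ : V → EuclideanSpace ℂ (Fin q)) (U : Circuit q V) (T : ℕ)
    (a : V) (ℓ : ℕ) : (intervalState φ U T a ℓ).IsHermitian :=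
  (isHermitian_circuitState φ U T _).submatrix _

lemma continuous_intervalState (φ : V → EuclideanSpace ℂ (Fin q)) (T : ℕ) (a : V) (ℓ : ℕ) :
    Continuous fun U => intervalState φ U T a ℓ :=
  (continuous_circuitState φ T _).matrix_submatrix _ _

lemma trace_intervalState (hq : 1 ≤ q) (hV : AlternatingParity V)
    {φ : V → EuclideanSpace ℂ (Fin q)} (hφ : ∀ x, ‖φ x‖ = 1) (U : Circuit q V) (T : ℕ)
    (a : V) {ℓ : ℕ} (h : CastInjBelow V ℓ) : (intervalState φ U T a ℓ).trace = 1 := by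
  rw [intervalState_eq_submatrix φ U T a h, ← trace_circuitState hq hV hφ U T (interval a ℓ)]
  exact (labelEquiv a h).sum_comp fun i => circuitState φ U T (interval a ℓ) i i

lemma purity_intervalState (φ : V → EuclideanSpace ℂ (Fin q)) (U : Circuit q V) (T : ℕ)
    (a : V) {ℓ : ℕ} (h : CastInjBelow V ℓ) :
    purity (intervalState φ U T a ℓ)
      = (sitePurity (fun z : interval a ℓ => z.1 ∈ interval a ℓ)
        (circuitState φ U T (interval a ℓ))).re := by
  rw [intervalState_eq_submatrix φ U T a h, purity_submatrix, purity]
  congr 1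
  have hm : ∀ s s' : interval a ℓ → Fin q,
      siteMix (fun z : interval a ℓ => z.1 ∈ interval a ℓ) s s' = s := fun s s' =>
    funext fun z => if_pos z.2
  simp only [sitePurity, swapPurity, hm, Matrix.trace, Matrix.diag, Matrix.mul_apply]

variable [Countable V]

lemma integrable_purity_intervalState (φ : V → EuclideanSpace ℂ (Fin q)) (T : ℕ) (a : V) (ℓ : ℕ) :
    Integrable (fun U => purity (intervalState φ U T a ℓ)) (circuitMeasure q V) := by
  have h := continuous_intervalState φ T a ℓ
  exact integrable_of_continuous (Complex.continuous_re.comp (h.matrix_mul h).matrix_trace)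

lemma avgPurity_eq_purityRec (hq : 1 ≤ q) (hV : AlternatingParity V)
    {φ : V → EuclideanSpace ℂ (Fin q)} (hφ : ∀ x, ‖φ x‖ = 1) {T d : ℕ} {a : V}
    (hinj : CastInjBelow V (2 * d + 2 * T)) (ha : 0 < T → ¬ Even (a + (T : V))) :
    avgPurity φ T a (2 * d) = purityRec q T d := by
  have h := integral_sitePurity_interval hq hV hφ T d a (interval a (2 * d)) subset_rfl hinj
    fun _ => ha
  simp only [avgPurity, purity_intervalState φ _ T a (hinj.mono (Nat.le_add_right (2 * d) (2 * T)))]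
  have hi : Integrable (fun U => sitePurity (fun z : interval a (2 * d) => z.1 ∈ interval a (2 * d))
      (circuitState φ U T (interval a (2 * d)))) (circuitMeasure q V) :=
    integrable_of_continuous ((continuous_sitePurity _).comp (continuous_circuitState φ T _))
  have h2 := integral_re hi
  rw [h] at h2
  exact h2

lemma integrable_traceNorm_intervalState_sq (φ : V → EuclideanSpace ℂ (Fin q)) (T : ℕ) (a : V)
    (ℓ : ℕ) : Integrable (fun U => traceNorm (intervalState φ U T a ℓ - maxMixed q ℓ) ^ 2)
      (circuitMeasure q V) :=
  integrable_traceNorm_sq ((continuous_intervalState φ T a ℓ).sub continuous_const)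

lemma integral_hsNorm_sq (hq : 1 ≤ q) (hV : AlternatingParity V)
    {φ : V → EuclideanSpace ℂ (Fin q)} (hφ : ∀ x, ‖φ x‖ = 1) (T : ℕ) (a : V) {ℓ : ℕ}
    (hinj : CastInjBelow V ℓ) :
    ∫ U, hsNorm (intervalState φ U T a ℓ - maxMixed q ℓ) ^ 2 ∂(circuitMeasure q V)
      = avgPurity φ T a ℓ - ((q : ℝ) ^ ℓ)⁻¹ := by
  simp only [hsNorm_sub_maxMixed_sq hq (isHermitian_intervalState φ _ T a ℓ)
    (trace_intervalState hq hV hφ _ T a hinj)]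
  rw [integral_sub (integrable_purity_intervalState φ T a ℓ) (integrable_const _)]
  simp [avgPurity]

lemma rpow_mul_sqrt_integral_hsNorm_sq (hq : 1 ≤ q) (hV : AlternatingParity V)
    {φ : V → EuclideanSpace ℂ (Fin q)} (hφ : ∀ x, ‖φ x‖ = 1) (T : ℕ) (a : V) {ℓ : ℕ}
    (hinj : CastInjBelow V ℓ) :
    (q : ℝ) ^ ((ℓ : ℝ) / 2)
        * √(∫ U, hsNorm (intervalState φ U T a ℓ - maxMixed q ℓ) ^ 2 ∂(circuitMeasure q V))
      = √((q : ℝ) ^ ℓ * avgPurity φ T a ℓ - 1) := by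
  have hq0 : (q : ℝ) ≠ 0 := by positivity
  rw [integral_hsNorm_sq hq hV hφ T a hinj, rpow_half_eq_sqrt, ← Real.sqrt_mul (by positivity),
    mul_sub, mul_inv_cancel₀ (pow_ne_zero _ hq0)]

lemma integral_traceNorm_sq_le (hq : 1 ≤ q) (hV : AlternatingParity V)
    {φ : V → EuclideanSpace ℂ (Fin q)} (hφ : ∀ x, ‖φ x‖ = 1) (T : ℕ) (a : V) {ℓ : ℕ}
    (hinj : CastInjBelow V ℓ) :
    ∫ U, traceNorm (intervalState φ U T a ℓ - maxMixed q ℓ) ^ 2 ∂(circuitMeasure q V)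
      ≤ (q : ℝ) ^ ℓ * avgPurity φ T a ℓ - 1 := by
  have hq0 : (q : ℝ) ≠ 0 := by positivity
  have hc := (continuous_intervalState φ T a ℓ).sub (continuous_const (y := maxMixed q ℓ))
  calc _ ≤ ∫ U, (q : ℝ) ^ ℓ * hsNorm (intervalState φ U T a ℓ - maxMixed q ℓ) ^ 2
        ∂(circuitMeasure q V) := by
        refine integral_mono (integrable_traceNorm_intervalState_sq φ T a ℓ)
          ((integrable_of_continuous (continuous_hsNorm_sq hc)).const_mul _) fun U => ?_
        have := traceNorm_sq_le (intervalState φ U T a ℓ - maxMixed q ℓ)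
        rwa [card_config] at this
    _ = _ := by
        rw [integral_const_mul, integral_hsNorm_sq hq hV hφ T a hinj, mul_sub,
          mul_inv_cancel₀ (pow_ne_zero _ hq0)]

end IntervalState

/-! ### The infinite chain and the circle -/

lemma alternatingParity_int : AlternatingParity ℤ := fun _ => Int.even_add_one

lemma castInjBelow_int (n : ℕ) : CastInjBelow ℤ n := fun _ _ _ _ h => by exact_mod_cast h

lemma AlternatingParity.not_even_of_odd {R : Type} [CommRing R] (hR : AlternatingParity R) {x : R}
    (h : Odd x) : ¬ Even x := by
  rw [← hR]
  exact h.add_one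

/-- For even L the reduction to ℤ/2 is defined, and its kernel is the set of even residues. -/
lemma alternatingParity_zmod {L : ℕ} [NeZero L] (hL : Even L) : AlternatingParity (ZMod L) := by
  have hd : 2 ∣ L := even_iff_two_dvd.mp hL
  have h : ∀ x : ZMod L, Even x ↔ ZMod.castHom hd (ZMod 2) x = 0 := by
    intro x
    constructor
    · rintro ⟨y, rfl⟩
      rw [map_add]
      exact CharTwo.add_self_eq_zero _
    · intro hx
      rw [← ZMod.natCast_zmod_val x] at hx ⊢
      rw [map_natCast, ZMod.natCast_eq_zero_iff] at hx
      exact (even_iff_two_dvd.mpr hx).natCast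
  intro x
  rw [h, h, map_add, map_one]
  generalize ZMod.castHom hd (ZMod 2) x = y
  revert y
  decide

lemma castInjBelow_zmod (L : ℕ) : CastInjBelow (ZMod L) L := by
  intro i hi j hj h
  rw [ZMod.natCast_eq_natCast_iff'] at h
  rwa [Nat.mod_eq_of_lt hi, Nat.mod_eq_of_lt hj] at h

/-! ### The estimates in the form of the theorem -/

lemma thermal_estimate {q : ℕ} (hq : 2 ≤ q) {d T : ℕ} (hd : 1 ≤ d) {ε : ℝ} (hε : 0 < ε)
    (hε2 : ε ≤ 2)
    (hT : ((3 ≤ q ∨ (2 : ℝ) ^ (-(4 * (2 * d : ℕ) : ℝ)) ≤ ε) ∧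
        ((2 * d : ℕ) : ℝ) / 2 * (1 + 3 * (Real.log 2 / Real.log q))
          + 3 * Real.log (1 / ε) / Real.log q < T) ∨
      (q = 2 ∧
        ((2 * d : ℕ) : ℝ) / 2 * (1 + 3 * (Real.log 2 / Real.log q))
          + 4 * Real.log (1 / ε) / Real.log q < T)) :
    (q : ℝ) ^ (2 * d) * purityRec q T d - 1 < ε ^ 2 := by
  have hb := neg_log_two_le_log_one_div hε hε2
  refine pow_mul_purityRec_sub_one_lt (by omega) hε ?_
  have hd2 : ((2 * d : ℕ) : ℝ) / 2 = d := by push_cast; ring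
  rw [hd2] at hT
  rcases hT with ⟨h1, h2⟩ | ⟨rfl, h2⟩
  · rcases Nat.lt_or_ge 2 q with hq3 | hq3
    · exact thermal_time_of_three_le hq3 hd hb (Nat.cast_nonneg T) h2
    · obtain rfl : q = 2 := le_antisymm hq3 hq
      have h3 : (2 : ℝ) ^ (-(4 * (2 * d : ℕ) : ℝ)) ≤ ε := h1.resolve_left (by norm_num)
      refine thermal_time_two hd ?_ h2
      have h4 := Real.log_le_log (by positivity) h3
      rw [Real.log_rpow (by norm_num)] at h4
      rw [one_div, Real.log_inv]
      push_cast at h4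
      linarith
  · exact thermal_time_two' hd hb h2

/-- With L = 2m and x = log 2 / log q one has T₁ + d = 2d(1 + 3x) ≤ m(1 - 6x)(1 + 3x) ≤ m. Rounding
T₁ up adds less than 1, which integrality of m absorbs. -/
lemma ceil_time_le {q d L : ℕ} (hq : 2 ≤ q) (hd : 1 ≤ d) (hL : Even L)
    (h : ((2 * d : ℕ) : ℝ) < (L : ℝ) / 2 * (1 - 6 * (Real.log 2 / Real.log q))) :
    2 * d + 2 * ⌈((2 * d : ℕ) : ℝ) / 2 * (1 + 6 * (Real.log 2 / Real.log q))⌉₊ ≤ L := by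
  have hl2 : 0 < Real.log 2 := Real.log_pos (by norm_num)
  have hlq : 0 < Real.log q := Real.log_pos (by exact_mod_cast hq)
  set x := Real.log 2 / Real.log q with hx
  have hx0 : 0 < x := by positivity
  obtain ⟨m, rfl⟩ := hL.two_dvd
  have hd1 : (1 : ℝ) ≤ d := by exact_mod_cast hd
  push_cast at h
  have h1 : (2 : ℝ) * d < m * (1 - 6 * x) := by linarith
  have hc := Nat.ceil_lt_add_one (a := ((2 * d : ℕ) : ℝ) / 2 * (1 + 6 * x)) (by positivity)
  have h2 : ((2 * d : ℕ) : ℝ) / 2 * (1 + 6 * x) + d ≤ m := by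
    push_cast
    have h3 : 2 * (d : ℝ) * (1 + 3 * x) ≤ m * (1 - 6 * x) * (1 + 3 * x) :=
      mul_le_mul_of_nonneg_right h1.le (by positivity)
    have h4 : 0 ≤ (m : ℝ) * (3 * x + 18 * x ^ 2) := by positivity
    linarith
  have h5 : (⌈((2 * d : ℕ) : ℝ) / 2 * (1 + 6 * x)⌉₊ : ℝ) + d < m + 1 := by linarith
  have h6 : ⌈((2 * d : ℕ) : ℝ) / 2 * (1 + 6 * x)⌉₊ + d < m + 1 := by exact_mod_cast h5
  omega

lemma half_circle_estimate {q d T : ℕ} (hq : 3 ≤ q) (hd : 1 ≤ d)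
    (hT : ((2 * d : ℕ) : ℝ) / 2 * (1 + 6 * (Real.log 2 / Real.log q)) ≤ T) :
    (q : ℝ) ^ (2 * d) * purityRec q T d - 1 < ((2 : ℝ) ^ (-(((2 * d : ℕ) : ℝ) / 2))) ^ 2 := by
  have hd2 : ((2 * d : ℕ) : ℝ) / 2 = d := by push_cast; ring
  rw [hd2] at hT ⊢
  refine pow_mul_purityRec_sub_one_lt (by omega) (by positivity) ?_
  rw [one_div, Real.log_inv, Real.log_rpow (by norm_num)]
  have := thermal_time_half hq hd hT
  linarith

/-- For q = 2 the factor 1 - 6 log 2 / log q is -5, so no length is admissible. -/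
lemma three_le_of_lt_half {q ℓ L : ℕ} (hq : 2 ≤ q)
    (h : (ℓ : ℝ) < (L : ℝ) / 2 * (1 - 6 * (Real.log 2 / Real.log q))) : 3 ≤ q := by
  by_contra hn
  obtain rfl : q = 2 := by omega
  have hl2 : 0 < Real.log 2 := Real.log_pos (by norm_num)
  rw [Nat.cast_ofNat, div_self hl2.ne'] at h
  have h1 : (0 : ℝ) ≤ ℓ := Nat.cast_nonneg ℓ
  have h2 : (0 : ℝ) ≤ L := Nat.cast_nonneg L
  linarith

end

end Brickwork

/-! ### Assembly of the theorem -/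

open Brickwork in
theorem mainTheorem1 (q ℓ : ℕ) (hq : 1 ≤ q) (hℓ : Even ℓ) (hℓ2 : 2 ≤ ℓ) :
    -- the purity of an interval on the infinite chain, and the trace norm in terms of it
    (∀ (φ : ℤ → EuclideanSpace ℂ (Fin q)), (∀ x, ‖φ x‖ = 1) →
      ∀ (T : ℕ) (a : ℤ), (0 < T → Odd (a + T)) →
        Integrable (fun U => purity (intervalState φ U T a ℓ)) (circuitMeasure q ℤ) ∧
        (1 - ((q : ℝ) ^ 2)⁻¹) / (T + 1) * ((2 * T).choose T : ℝ)
            * ((q : ℝ) / ((q : ℝ) ^ 2 + 1)) ^ (2 * T)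
          ≤ avgPurity φ T a ℓ - 1 / (q : ℝ) ^ ℓ ∧
        avgPurity φ T a ℓ - 1 / (q : ℝ) ^ ℓ
          ≤ (2 * (q : ℝ) / ((q : ℝ) ^ 2 + 1)) ^ (2 * T) ∧
        Integrable (fun U => traceNorm (intervalState φ U T a ℓ - maxMixed q ℓ) ^ 2)
          (circuitMeasure q ℤ) ∧
        (∀ U : Circuit q ℤ, traceNorm (intervalState φ U T a ℓ - maxMixed q ℓ)
          ≤ (q : ℝ) ^ ((ℓ : ℝ) / 2) * hsNorm (intervalState φ U T a ℓ - maxMixed q ℓ)) ∧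
        (q : ℝ) ^ ((ℓ : ℝ) / 2)
            * √(∫ U, hsNorm (intervalState φ U T a ℓ - maxMixed q ℓ) ^ 2 ∂(circuitMeasure q ℤ))
          = √((q : ℝ) ^ ℓ * avgPurity φ T a ℓ - 1) ∧
        √(∫ U, traceNorm (intervalState φ U T a ℓ - maxMixed q ℓ) ^ 2 ∂(circuitMeasure q ℤ))
          ≤ √((q : ℝ) ^ ℓ * avgPurity φ T a ℓ - 1) ∧
        -- thermalization on the infinite chain
        (2 ≤ q → ∀ ε : ℝ, 0 < ε → ε ≤ 2 →
          (((3 ≤ q ∨ (2 : ℝ) ^ (-(4 * ℓ : ℝ)) ≤ ε) ∧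
            (ℓ : ℝ) / 2 * (1 + 3 * (Real.log 2 / Real.log q))
              + 3 * Real.log (1 / ε) / Real.log q < T) ∨
          (q = 2 ∧
            (ℓ : ℝ) / 2 * (1 + 3 * (Real.log 2 / Real.log q))
              + 4 * Real.log (1 / ε) / Real.log q < T)) →
          √((q : ℝ) ^ ℓ * avgPurity φ T a ℓ - 1) < ε ∧
          ∀ δ : ℝ, 0 < δ →
            (circuitMeasure q ℤ).real {U | complexity δ (intervalState φ U T a ℓ) ≠ 0}
              ≤ (ε / (2 * δ)) ^ 2)) ∧
    -- on a circle the averaged purity is the same as long as the light cone fits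
    (∀ L : ℕ, Even L → ∀ T : ℕ, ℓ + 2 * T ≤ L →
      ∀ (φ : ℤ → EuclideanSpace ℂ (Fin q)) (ψ : ZMod L → EuclideanSpace ℂ (Fin q)),
        (∀ x, ‖φ x‖ = 1) → (∀ x, ‖ψ x‖ = 1) →
      ∀ (a : ℤ) (b : ZMod L), (0 < T → Odd (a + T)) → (0 < T → Odd (b + T)) →
        Integrable (fun U => purity (intervalState ψ U T b ℓ)) (circuitMeasure q (ZMod L)) ∧
        avgPurity ψ T b ℓ = avgPurity φ T a ℓ) ∧
    -- thermalization of an interval smaller than half of a circle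
    (2 ≤ q → ∀ L : ℕ, Even L →
      (ℓ : ℝ) < (L : ℝ) / 2 * (1 - 6 * (Real.log 2 / Real.log q)) →
      ℓ + 2 * ⌈(ℓ : ℝ) / 2 * (1 + 6 * (Real.log 2 / Real.log q))⌉₊ ≤ L ∧
      ∀ T : ℕ, (ℓ : ℝ) / 2 * (1 + 6 * (Real.log 2 / Real.log q)) ≤ T → ℓ + 2 * T ≤ L →
      ∀ (ψ : ZMod L → EuclideanSpace ℂ (Fin q)), (∀ x, ‖ψ x‖ = 1) →
      ∀ b : ZMod L, Odd (b + T) →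
        Integrable (fun U => traceNorm (intervalState ψ U T b ℓ - maxMixed q ℓ) ^ 2)
          (circuitMeasure q (ZMod L)) ∧
        √(∫ U, traceNorm (intervalState ψ U T b ℓ - maxMixed q ℓ) ^ 2
            ∂(circuitMeasure q (ZMod L))) < (2 : ℝ) ^ (-((ℓ : ℝ) / 2)) ∧
        ∀ δ : ℝ, 0 < δ →
          (circuitMeasure q (ZMod L)).real {U | complexity δ (intervalState ψ U T b ℓ) ≠ 0}
            ≤ ((2 : ℝ) ^ (-((ℓ : ℝ) / 2)) / (2 * δ)) ^ 2) := by
  obtain ⟨d, rfl⟩ := hℓ.two_dvd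
  have hd : 1 ≤ d := by omega
  have hpow : ((q : ℝ) ^ 2)⁻¹ ^ d = 1 / (q : ℝ) ^ (2 * d) := by
    rw [inv_pow, ← pow_mul, one_div]
  have hZ := alternatingParity_int
  have hodd : ∀ (T : ℕ) (a : ℤ), (0 < T → Odd (a + T)) → 0 < T → ¬ Even (a + (T : ℤ)) :=
    fun T a h hT => hZ.not_even_of_odd (h hT)
  refine ⟨fun φ hφ T a ha => ?_, fun L hL T hLT φ ψ hφ hψ a b ha hb => ?_, fun hq2 L hL hlt => ?_⟩
  · have havg := avgPurity_eq_purityRec hq hZ hφ (d := d) (castInjBelow_int _) (hodd T a ha)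
    have hinj := castInjBelow_int (2 * d)
    have htn := integral_traceNorm_sq_le hq hZ hφ T a hinj
    refine ⟨integrable_purity_intervalState φ T a _, ?_, ?_,
      integrable_traceNorm_intervalState_sq φ T a _, fun U => traceNorm_le_rpow_mul_hsNorm _,
      rpow_mul_sqrt_integral_hsNorm_sq hq hZ hφ T a hinj, Real.sqrt_le_sqrt htn,
      fun hq2 ε hε hε2 hT => ?_⟩
    · rw [havg, ← hpow]
      exact purityRec_sub_ge_catalan hq T d hd
    · rw [havg, ← hpow]
      refine (purityRec_sub_bounds hq T d).2.trans_eq ?_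
      rw [pow_mul, cutWeight]
      congr 1
      ring
    · have h := thermal_estimate hq2 hd hε hε2 hT
      rw [← havg] at h
      refine ⟨(Real.sqrt_lt' hε).mpr h, fun δ hδ => ?_⟩
      exact measureReal_complexity_ne_zero_le hq (integrable_traceNorm_intervalState_sq φ T a _)
        hδ (htn.trans h.le)
  · have : NeZero L := ⟨by omega⟩
    have hV := alternatingParity_zmod hL
    refine ⟨integrable_purity_intervalState ψ T b _, ?_⟩
    -- Both averages equal `purityRec q T d`, which depends neither on the geometry nor on the
    -- initial states; ℓ + 2T ≤ L gives the distinct sites needed on the circle.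
    rw [avgPurity_eq_purityRec hq hZ hφ (castInjBelow_int _) (hodd T a ha),
      avgPurity_eq_purityRec hq hV hψ ((castInjBelow_zmod L).mono (by omega))
        fun hT => hV.not_even_of_odd (hb hT)]
  · refine ⟨ceil_time_le hq2 hd hL hlt, fun T hT hLT ψ hψ b hb => ?_⟩
    have : NeZero L := ⟨by omega⟩
    have hV := alternatingParity_zmod hL
    have hinj : CastInjBelow (ZMod L) (2 * d) := (castInjBelow_zmod L).mono (by omega)
    have htn := integral_traceNorm_sq_le hq hV hψ T b hinj
    have h := half_circle_estimate (three_le_of_lt_half hq2 hlt) hd hT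
    rw [← avgPurity_eq_purityRec hq hV hψ ((castInjBelow_zmod L).mono (by omega))
        fun _ => hV.not_even_of_odd hb] at h
    have hi := integrable_traceNorm_intervalState_sq ψ T b (2 * d)
    exact ⟨hi, (Real.sqrt_lt' (by positivity)).mpr (htn.trans_lt h), fun δ hδ =>
      measureReal_complexity_ne_zero_le hq hi hδ (htn.trans h.le)⟩
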